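/- Let $k$ be an odd positive integer, let $i\ge 0$ be an integer with $\gcd(i,k)=1$, let $0\le t\le k-1$, put $e=(2^i+1)2^t$, and let $\alpha\in\mathbb{F}_{2^k}$ with $\alpha\neq 0,1$. For $z\in\mathbb{F}_{2^k}$ let $R_z(x)=(x+\alpha z)^e+z^e$; since $x\mapsto x^e$ permutes $\mathbb{F}_{2^k}$, so does $R_z$. Define the open and the closed butterfly, two functions $\mathbb{F}_{2^k}^2\to\mathbb{F}_{2^k}^2$, by $$\mathsf{H}_e^{\alpha}(x,y)=\bigl(R_{R_y^{-1}(x)}(y),\,R_y^{-1}(x)\bigr),\qquad \mathsf{V}_e^{\alpha}(x,y)=\bigl(R_x(y),\,R_y(x)\bigr).$$ For $F=(F_1,F_2):\mathbb{F}_{2^k}^2\to\mathbb{F}_{2^k}^2$ and $(a,b),(c,d)\in\mathbb{F}_{2^k}^2$ let $$\mathcal{W}_F((a,b),(c,d))=\sum_{x,y\in\mathbb{F}_{2^k}}(-1)^{\mathrm{Tr}(cF_1(x,y)+dF_2(x,y)+ax+by)},$$ where $\mathrm{Tr}:\mathbb{F}_{2^k}\to\mathbb{F}_2$ is the absolute trace.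 The Walsh spectrum of $F$ is $\Lambda_F=\{\mathcal{W}_F((a,b),(c,d)) : (a,b),(c,d)\in\mathbb{F}_{2^k}^2,\ (c,d)\neq(0,0)\}$, and its nonlinearity is $\mathcal{NL}(F)=2^{2k-1}-\tfrac12\max_{w\in\Lambda_F}|w|$. Then $\mathcal{NL}(\mathsf{H}_e^{\alpha})=\mathcal{NL}(\mathsf{V}_e^{\alpha})=2^{2k-1}-2^k$. Thus both functions are optimal nonlinear functions, in the usual sense that their nonlinearity is the largest known value $2^{n-1}-2^{n/2}$ in even dimension $n=2k$. Moreover $$\Lambda_{\mathsf{H}_e^{\alpha}}=\Lambda_{\mathsf{V}_e^{\alpha}}=\{0,\pm 2^k,\pm 2^{k+1}\}.$$ -/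

import Mathlib

namespace Butterfly

section Maps

variable {K : Type*} [Field K]

/-- The keyed map `R_z[e, α](x) = (x + α z) ^ e + z ^ e`. -/
def keyedPerm (e : ℕ) (α z x : K) : K := (x + α * z) ^ e + z ^ e

/-- The inverse `R_z⁻¹[e, α]` of the keyed permutation. It is a genuine two-sided inverse as soon as
`x ↦ x ^ e` is a permutation of `K`, see `keyedPerm_keyedPermInv` and `keyedPermInv_keyedPerm`. -/
noncomputable def keyedPermInv (e : ℕ) (α z : K) : K → K :=
  Function.invFun (keyedPerm e α z)

/-- The open butterfly `H_e^α(x, y) = (R_{R_y⁻¹(x)}(y), R_y⁻¹(x))`. -/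
noncomputable def openButterfly (e : ℕ) (α : K) (p : K × K) : K × K :=
  (keyedPerm e α (keyedPermInv e α p.2 p.1) p.2, keyedPermInv e α p.2 p.1)

/-- The closed butterfly `V_e^α(x, y) = (R_x(y), R_y(x))`. -/
def closedButterfly (e : ℕ) (α : K) (p : K × K) : K × K :=
  (keyedPerm e α p.1 p.2, keyedPerm e α p.2 p.1)

theorem keyedPerm_bijective {e : ℕ} (he : Function.Bijective (fun x : K => x ^ e)) (α z : K) :
    Function.Bijective (keyedPerm e α z) :=
  ((Equiv.addRight (z ^ e)).bijective.comp he).comp (Equiv.addRight (α * z)).bijective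

theorem keyedPerm_keyedPermInv {e : ℕ} (he : Function.Bijective (fun x : K => x ^ e))
    (α z x : K) : keyedPerm e α z (keyedPermInv e α z x) = x :=
  Function.rightInverse_invFun (keyedPerm_bijective he α z).2 x

theorem keyedPermInv_keyedPerm {e : ℕ} (he : Function.Bijective (fun x : K => x ^ e))
    (α z x : K) : keyedPermInv e α z (keyedPerm e α z x) = x :=
  Function.leftInverse_invFun (keyedPerm_bijective he α z).1 x

/-- The exponents `(2 ^ i + 1) * 2 ^ t` give permutations of the field with `2 ^ k` elements when
`k` is odd and coprime to `i`. -/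
theorem exponent_bijective [Fintype K] {k : ℕ} (hK : Fintype.card K = 2 ^ k) (hk : Odd k)
    {i : ℕ} (hi : Nat.Coprime i k) (t : ℕ) :
    Function.Bijective (fun x : K => x ^ ((2 ^ i + 1) * 2 ^ t)) := by
  classical
  have hodd : Nat.Coprime (2 ^ t) (2 ^ k - 1) := by
    apply Nat.Coprime.pow_left
    rw [Nat.coprime_two_left]
    exact Nat.Even.sub_odd Nat.one_le_two_pow
      ((Nat.even_pow.2 ⟨even_two, hk.pos.ne'⟩)) odd_one
  have h2 : Nat.Coprime (2 ^ i + 1) (2 ^ k - 1) := by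
    have h3 : Nat.gcd (2 ^ (2 * i) - 1) (2 ^ k - 1) = 1 := by
      rw [Nat.pow_sub_one_gcd_pow_sub_one]
      have : Nat.gcd (2 * i) k = 1 :=
        Nat.Coprime.mul_left (Nat.coprime_two_left.2 hk) hi
      simp [this]
    apply Nat.Coprime.coprime_dvd_left _ h3
    refine ⟨2 ^ i - 1, ?_⟩
    rw [mul_comm 2 i, pow_mul, ← Nat.sq_sub_sq, one_pow]
  have hcop : (Nat.card Kˣ).Coprime ((2 ^ i + 1) * 2 ^ t) := by
    rw [Nat.card_eq_fintype_card, Fintype.card_units, hK]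
    exact (Nat.Coprime.mul_left h2 hodd).symm
  have hne : (2 ^ i + 1) * 2 ^ t ≠ 0 := by positivity
  refine Finite.injective_iff_bijective.1 fun x y hxy => ?_
  change x ^ _ = y ^ _ at hxy
  by_cases hx : x = 0
  · subst hx
    rw [zero_pow hne] at hxy
    exact (pow_eq_zero_iff hne).1 hxy.symm |>.symm
  by_cases hy : y = 0
  · subst hy
    rw [zero_pow hne] at hxy
    exact (pow_eq_zero_iff hne).1 hxy
  have := (powCoprime hcop).injective (a₁ := Units.mk0 x hx) (a₂ := Units.mk0 y hy)
    (Units.ext (by simpa using hxy))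
  simpa using congrArg Units.val this

end Maps

section Walsh

variable {K : Type*} [Field K] [Fintype K] [Algebra (ZMod 2) K]

/-- The Walsh transform of `F : K × K → K × K` at `(a, b)`, with `a = (a₁, a₂)`, `b = (b₁, b₂)`:
the sum over all `x = (x₁, x₂)` of `(-1) ^ Tr (b₁ F₁(x) + b₂ F₂(x) + a₁ x₁ + a₂ x₂)`, where `Tr` is
the absolute trace of `K`. -/
noncomputable def walsh (F : K × K → K × K) (a b : K × K) : ℤ :=
  ∑ x : K × K, (-1 : ℤ) ^
    (Algebra.trace (ZMod 2) K
      (b.1 * (F x).1 + b.2 * (F x).2 + a.1 * x.1 + a.2 * x.2)).val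

/-- The Walsh spectrum: the set of values of the Walsh transform at `(a, b)` with `b ≠ 0`. -/
def walshSpectrum (F : K × K → K × K) : Set ℤ :=
  {w | ∃ a b : K × K, b ≠ 0 ∧ walsh F a b = w}

/-- The nonlinearity `2 ^ (n - 1) - (1 / 2) max_{a, b ≠ 0} |W_F(a, b)|`, where `n` is the dimension
of `K × K` over the field with two elements. The supremum is over a finite non-empty set. -/
noncomputable def nonlinearity (F : K × K → K × K) : ℝ :=
  2 ^ (Module.finrank (ZMod 2) (K × K) - 1) -
    (1 / 2) * ⨆ p : (K × K) × {b : K × K // b ≠ 0}, |(walsh F p.1 p.2.1 : ℝ)|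

/-- `F` is an optimal (maximal) nonlinear function on a space of even dimension `n` over the field
with two elements: its nonlinearity is the largest known value `2 ^ (n - 1) - 2 ^ (n / 2)`. -/
def IsOptimalNonlinear (F : K × K → K × K) : Prop :=
  nonlinearity F = 2 ^ (Module.finrank (ZMod 2) (K × K) - 1) -
    2 ^ (Module.finrank (ZMod 2) (K × K) / 2)

end Walsh

end Butterfly

/-! Let σ be x ↦ x^(2^i). Since gcd(2i, k) = 1, its square fixes only 0 and 1. Up to a Frobenius
twist, a component of the closed butterfly is Tr T(p, p) for a sesquilinear form T(p, q) = pᵀ N σ(q)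
with N a 2 × 2 matrix. Hence each Walsh value squares to 0 or to 2^(2k)·|R|, where R is the radical
of the polarization (`sq_sum_sign_eq`).

On R the form T is fixed by σ², so it takes only the values 0 and 1; if det N ≠ 0 this forces |R| ≤
4. If det N = 0, a nonzero vector of R would make N proportional to some a σ(a)ᵀ, which
`pencil_ne_rank_one` excludes. So only 0, ±2^k and ±2^(k+1) can occur.

They all occur, by the first two moments, once one component has |R| ≥ 2, namely (1, 0), and one has
|R| ≤ 2. For the latter, |R| > 2 gives an isotropic vector of T, hence a σ-semilinear eigenvector of
the row-exchanged matrix B, and then B σ(B) ⋯ σ^(k-1)(B) has trace 0. Along a pencil this trace is a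
polynomial in the conjugates of the parameter with a nonzero coefficient
(`exists_trace_twistedProd_ne_zero`).

The graph of the open butterfly is that of the closed one with two coordinates exchanged, so its
spectrum is the same. -/

namespace Butterfly

/-! ### Singular members of the pencil of matrices N. -/

section FieldAlgebra

variable {K : Type*} [Field K]

/-- If the square of a ring endomorphism fixes only `0` and `1`, so does the endomorphism. -/
theorem eq_zero_or_one_of_map_eq {σ : K →+* K} (hσ : ∀ x, σ (σ x) = x → x = 0 ∨ x = 1) {x : K}
    (h : σ x = x) : x = 0 ∨ x = 1 :=
  hσ x (by rw [h, h])

theorem eq_one_of_mul_map_eq_one {σ : K →+* K} (hσ : ∀ x, σ (σ x) = x → x = 0 ∨ x = 1) {x : K}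
    (h : x * σ x = 1) : x = 1 := by
  have hx : x ≠ 0 := left_ne_zero_of_mul_eq_one h
  have h1 : σ x * σ (σ x) = 1 := by rw [← map_mul, h, map_one]
  have hs : σ x ≠ 0 := left_ne_zero_of_mul_eq_one h1
  refine (hσ x (mul_left_cancel₀ hs ?_)).resolve_left hx
  rw [h1, mul_comm, h]

theorem map_ne_add_one (h2 : (2 : K) = 0) {σ : K →+* K}
    (hσ : ∀ x, σ (σ x) = x → x = 0 ∨ x = 1) (x : K) : σ x ≠ x + 1 := by
  intro h
  have h1 : σ (σ x) = x := by rw [h, map_add, map_one, h]; linear_combination h2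
  rcases hσ x h1 with rfl | rfl <;> simp at h

/-- The difference equation `x² + x₋₁ + x₁ + x x₋₁ x₁ = 0` has no nontrivial solutions: its
invariant `(x + y)(xy + x + y) / (1 + xy)` would be fixed by `σ`. -/
theorem eq_zero_or_one_of_recurrence (h2 : (2 : K) = 0) {σ : K →+* K}
    (hσ : ∀ x, σ (σ x) = x → x = 0 ∨ x = 1) {g h : K} (hg : σ g = h)
    (heq : h ^ 2 + g + σ h + h * g * σ h = 0) : h = 0 ∨ h = 1 := by
  have hfix := @eq_zero_or_one_of_map_eq _ _ σ hσ
  have hginj : ∀ {x}, g = x → σ x = x → h = 0 ∨ h = 1 := by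
    intro x hx hsx
    subst hx
    rw [hsx] at hg
    subst hg
    exact hfix hsx
  by_cases hd : 1 + g * h = 0
  · have h3 : g * σ g = 1 := by rw [hg]; linear_combination hd - h2
    have := eq_one_of_mul_map_eq_one hσ h3
    exact hginj this (map_one σ)
  set x := (g + h) * (g * h + g + h) / (1 + g * h) with hx
  have hd' : 1 + h * σ h ≠ 0 := by
    have := (map_ne_zero σ).2 hd
    rwa [map_add, map_mul, map_one, hg] at this
  have hxs : σ x = x := by
    rw [hx, map_div₀, map_mul, map_add, map_add, map_add, map_add, map_mul, map_one, hg,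
      div_eq_div_iff hd' hd]
    generalize σ h = k at *
    grind
  have hmul : x * (1 + g * h) = (g + h) * (g * h + g + h) := by
    rw [hx, div_mul_cancel₀ _ hd]
  rcases hfix hxs with h0 | h1
  · rw [h0, zero_mul, eq_comm, mul_eq_zero] at hmul
    rcases hmul with h3 | h3
    · exact hginj rfl (by rw [hg]; linear_combination h3 - g * h2)
    · have : (1 + g) * σ (1 + g) = 1 := by rw [map_add, map_one, hg]; linear_combination h3
      have := eq_one_of_mul_map_eq_one hσ this
      exact hginj (by linear_combination this : g = 0) (map_zero σ)
  · rw [h1, one_mul] at hmul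
    have h3 : (g + h + 1) * ((g + 1) * (h + 1)) = 0 := by grind
    rcases mul_eq_zero.1 h3 with h4 | h4
    · exact absurd (by rw [hg]; linear_combination h4 - (g + 1) * h2) (map_ne_add_one h2 hσ g)
    · rcases mul_eq_zero.1 h4 with h5 | h5
      · exact hginj (by linear_combination h5 - h2 : g = 1) (map_one σ)
      · exact Or.inr (by linear_combination h5 - h2)

/-- In the variable β = α + 1 the determinant depends on α only through β σ(β). -/
theorem pencil_det_identity {R : Type*} [CommRing R] (h2 : (2 : R) = 0) {β b c d : R}
    (h : (c * ((β + 1) * (b + 1) + 1) + d) * (c + d * ((β + 1) * (b + 1) + 1)) =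
      ((b + 1) * c + (β + 1) * d) * ((β + 1) * c + (b + 1) * d)) :
    c ^ 2 + d ^ 2 + c * d * ((β * b) ^ 2 + 1) = 0 := by
  grind

/-- Writing c/d as a square s² turns the determinant into a perfect square in characteristic 2. -/
theorem pencil_sqrt_identity {R : Type*} [CommRing R] (h2 : (2 : R) = 0) {γ s d : R}
    (h : (s ^ 2 * d) ^ 2 + d ^ 2 + s ^ 2 * d * d * (γ ^ 2 + 1) = 0) :
    d ^ 2 * (s * γ - (s ^ 2 + s + 1)) ^ 2 = 0 := by
  grind

/-- This is z = (s² + s b)/(1 + s b) for the ratio z of the second column. Exchanging β and b gives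
the analogue for the second row. -/
theorem pencil_ratio_identity {R : Type*} [CommRing R] (h2 : (2 : R) = 0) {β b s d z : R}
    (h : s * (β * b) = s ^ 2 + s + 1)
    (h3 : z * (s ^ 2 * d + d * ((β + 1) * (b + 1) + 1)) =
      (β + 1) * (s ^ 2 * d) + (b + 1) * d) :
    (s ^ 2 * d + d * ((β + 1) * (b + 1) + 1)) * (z * (1 + s * b)) =
      (s ^ 2 * d + d * ((β + 1) * (b + 1) + 1)) * (s ^ 2 + s * b) := by
  have h4 : ((β + 1) * s ^ 2 + (b + 1)) * (1 + s * b) =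
      (s ^ 2 + ((β + 1) * (b + 1) + 1)) * (s ^ 2 + s * b) := by
    clear h3
    grind
  linear_combination (1 + s * b) * h3 + d * h4

/-- Here z + 1 = (s² + 1)/(1 + s β); multiplying through by b eliminates β by `h`. -/
theorem ratio_add_one_identity {R : Type*} [CommRing R] (h2 : (2 : R) = 0) {β b s z : R}
    (h : s * (β * b) = s ^ 2 + s + 1) (hz : z * (1 + s * β) = s ^ 2 + s * β) :
    (z + 1) * (b + s ^ 2 + s + 1) = b * (s + 1) ^ 2 := by
  grind

theorem cross_ratio_identity {R : Type*} [CommRing R] (h2 : (2 : R) = 0) {b v t : R}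
    (h : b * (v + 1 + 1) ^ 2 * (b + (t + 1) ^ 2 + (t + 1) + 1) =
      b * (t + 1 + 1) ^ 2 * (b + (v + 1) ^ 2 + (v + 1) + 1)) :
    b * ((v + t) * ((v + t) * (b + 1) + v * t)) = b * 0 := by
  grind

/-- The hypothesis is s β σ(β) = s² + s + 1 at s = v + 1, after substituting α = uv/(u + v), σ(α) =
vt/(v + t) and clearing denominators. -/
theorem recurrence_identity {R : Type*} [CommRing R] (h2 : (2 : R) = 0) {u v t : R}
    (h : (v + 1) * ((u * v + u + v) * (v * t + v + t)) =
      (v ^ 2 + v + 1) * ((u + v) * (v + t))) :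
    v ^ 2 * (v ^ 2 + u + t + v * u * t) = v ^ 2 * 0 := by
  grind

/-- A singular matrix of the pencil attached to the butterfly is never a scalar multiple of
`a σ(a)ᵀ`. -/
theorem pencil_ne_rank_one [Finite K] (h2 : (2 : K) = 0) {σ : K →+* K}
    (hσ : ∀ x, σ (σ x) = x → x = 0 ∨ x = 1) {α : K} (hα0 : α ≠ 0) (hα1 : α ≠ 1) {c d : K}
    (hcd : c ≠ 0 ∨ d ≠ 0) {a₁ a₂ : K} (ha : a₁ ≠ 0 ∨ a₂ ≠ 0)
    (h1 : a₁ * (σ α * c + α * d) = a₂ * (c * (α * σ α + 1) + d))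
    (h3 : a₁ * (c + d * (α * σ α + 1)) = a₂ * (α * c + σ α * d))
    (h4 : σ a₁ * (α * c + σ α * d) = σ a₂ * (c * (α * σ α + 1) + d))
    (h5 : σ a₁ * (c + d * (α * σ α + 1)) = σ a₂ * (σ α * c + α * d)) : False := by
  have hfix := @eq_zero_or_one_of_map_eq _ _ σ hσ
  have hαs : α + σ α ≠ 0 := fun h => by
    rcases hfix (by linear_combination h - α * h2 : σ α = α) with h | h
    exacts [hα0 h, hα1 h]
  have hnz : ¬ (c + d * (α * σ α + 1) = 0 ∧ α * c + σ α * d = 0 ∧ σ α * c + α * d = 0) := by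
    rintro ⟨e1, e2, e3⟩
    have e4 : (α + σ α) * (c + d) = 0 := by linear_combination e2 + e3
    have e5 : c = d := by
      linear_combination (mul_eq_zero.1 e4).resolve_left hαs - d * h2
    subst e5
    have e6 : (α + σ α) * c = 0 := by linear_combination e2
    have := (mul_eq_zero.1 e6).resolve_left hαs
    simp [this] at hcd
  by_cases ha2 : a₂ = 0
  · subst ha2
    have ha1 : a₁ ≠ 0 := by simpa using ha
    have hs1 := (map_ne_zero σ).2 ha1
    simp only [zero_mul, map_zero, mul_eq_zero, ha1, hs1, false_or] at h1 h3 h4 h5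
    exact hnz ⟨h3, h4, h1⟩
  obtain ⟨z, hz⟩ : ∃ z, a₁ = z * a₂ := ⟨a₁ / a₂, by field_simp⟩
  have hs2 := (map_ne_zero σ).2 ha2
  rw [hz] at h1 h3
  rw [hz, map_mul] at h4 h5
  replace h1 := mul_left_cancel₀ ha2 (by linear_combination h1 :
    a₂ * (z * (σ α * c + α * d)) = a₂ * (c * (α * σ α + 1) + d))
  replace h3 := mul_left_cancel₀ ha2 (by linear_combination h3 :
    a₂ * (z * (c + d * (α * σ α + 1))) = a₂ * (α * c + σ α * d))
  replace h4 := mul_left_cancel₀ hs2 (by linear_combination h4 :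
    σ a₂ * (σ z * (α * c + σ α * d)) = σ a₂ * (c * (α * σ α + 1) + d))
  replace h5 := mul_left_cancel₀ hs2 (by linear_combination h5 :
    σ a₂ * (σ z * (c + d * (α * σ α + 1))) = σ a₂ * (σ α * c + α * d))
  have hn22 : c + d * (α * σ α + 1) ≠ 0 := fun h => by
    rw [h, mul_zero] at h3 h5
    exact hnz ⟨h, h3.symm, h5.symm⟩
  obtain ⟨β, hβ⟩ : ∃ β, α = β + 1 := ⟨α - 1, by ring⟩
  have hβ' : σ α = σ β + 1 := by rw [hβ, map_add, map_one]
  have hβ0 : β ≠ 0 := fun h => hα1 (by rw [hβ, h, zero_add])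
  have hβ1 : β ≠ 1 := fun h => hα0 (by rw [hβ, h]; linear_combination h2)
  have hdet : c ^ 2 + d ^ 2 + c * d * ((β * σ β) ^ 2 + 1) = 0 := by
    have : (c * (α * σ α + 1) + d) * (c + d * (α * σ α + 1)) =
        (σ α * c + α * d) * (α * c + σ α * d) := by
      rw [← h1, ← h3]; ring
    rw [hβ', hβ] at this
    exact pencil_det_identity h2 this
  have hd0 : d ≠ 0 := fun h => by
    subst h
    have : c = 0 := by simpa using hdet
    simp [this] at hcd
  obtain ⟨s, hs⟩ : ∃ s, c = s ^ 2 * d := by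
    have hinj : Function.Injective (fun x : K => x ^ 2) := fun x y hxy => by
      have hxy : x ^ 2 = y ^ 2 := hxy
      have : (x - y) ^ 2 = 0 := by linear_combination hxy + (y ^ 2 - x * y) * h2
      exact sub_eq_zero.1 (pow_eq_zero_iff (two_ne_zero)|>.1 this)
    obtain ⟨s, hs⟩ := Finite.surjective_of_injective hinj (c / d)
    exact ⟨s, by rw [show s ^ 2 = c / d from hs, div_mul_cancel₀ _ hd0]⟩
  have hsγ : s * (β * σ β) = s ^ 2 + s + 1 := by
    have h6 : d ^ 2 * (s * (β * σ β) - (s ^ 2 + s + 1)) ^ 2 = 0 := by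
      rw [hs] at hdet
      exact pencil_sqrt_identity h2 hdet
    have := (mul_eq_zero.1 h6).resolve_left (pow_ne_zero 2 hd0)
    exact sub_eq_zero.1 (pow_eq_zero_iff (two_ne_zero)|>.1 this)
  have hs0 : s ≠ 0 := fun h => by simp [h] at hsγ
  have hs1 : s ≠ 1 := fun h => hβ1 <| eq_one_of_mul_map_eq_one hσ <| by
    rw [h] at hsγ; linear_combination hsγ + h2
  have hsv : ∀ {v}, s = v + 1 → ¬ (v = 0 ∨ v = 1) := by
    rintro v hv (rfl | rfl)
    · exact hs1 (by rw [hv, zero_add])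
    · exact hs0 (by rw [hv]; linear_combination h2)
  rw [hβ', hβ, hs] at h3 h5 hn22
  have hz1 : z * (1 + s * σ β) = s ^ 2 + s * σ β :=
    mul_left_cancel₀ hn22 (pencil_ratio_identity h2 hsγ h3)
  have hz2 : σ z * (1 + s * β) = s ^ 2 + s * β := by
    rw [mul_comm (β + 1)] at h5 hn22
    exact mul_left_cancel₀ hn22 (pencil_ratio_identity h2 (by rw [mul_comm (σ β), hsγ]) h5)
  have hz3 : σ z * (1 + σ s * σ (σ β)) = σ s ^ 2 + σ s * σ (σ β) := by
    simpa using congrArg σ hz1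
  have hsγ' : σ s * (σ β * σ (σ β)) = σ s ^ 2 + σ s + 1 := by simpa using congrArg σ hsγ
  have hb0 : σ β ≠ 0 := (map_ne_zero σ).2 hβ0
  obtain ⟨v, hv⟩ : ∃ v, s = v + 1 := ⟨s - 1, by ring⟩
  have hv' : σ s = σ v + 1 := by rw [hv, map_add, map_one]
  -- Two formulas for σ(z), one direct and one obtained by applying σ to that for z, both express
  -- σ(z) + 1 through σ(β); equating them eliminates z.
  have hE : (v + σ v) * ((v + σ v) * σ α + v * σ v) = 0 := by
    have e1 : (σ z + 1) * (σ β + s ^ 2 + s + 1) = σ β * (s + 1) ^ 2 :=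
      ratio_add_one_identity h2 hsγ hz2
    have e2 : (σ z + 1) * (σ β + σ s ^ 2 + σ s + 1) = σ β * (σ s + 1) ^ 2 :=
      ratio_add_one_identity h2 (by rw [mul_comm (σ (σ β)), hsγ']) hz3
    have e3 : σ β * (s + 1) ^ 2 * (σ β + σ s ^ 2 + σ s + 1) =
        σ β * (σ s + 1) ^ 2 * (σ β + s ^ 2 + s + 1) := by
      rw [← e1, ← e2]; ring
    rw [hv', hv] at e3
    rw [hβ']
    exact mul_left_cancel₀ hb0 (cross_ratio_identity h2 e3)
  rcases mul_eq_zero.1 hE with h6 | h6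
  · exact hsv hv (hfix (by linear_combination h6 - v * h2))
  -- Pulling σ(α) = vσ(v)/(v + σ(v)) back along σ gives α = uv/(u + v).
  obtain ⟨u, hu⟩ := Finite.surjective_of_injective σ.injective v
  have h7 : (u + v) * α + u * v = 0 := by
    apply σ.injective
    rw [map_add, map_mul, map_mul, map_add, map_zero, hu, h6]
  have hv0 : v ≠ 0 := fun h => hsv hv (Or.inl h)
  refine hsv hv (eq_zero_or_one_of_recurrence h2 hσ hu (mul_left_cancel₀ (pow_ne_zero 2 hv0) ?_))
  have h8 : (v + 1) * ((u + v) * (α + 1) * ((v + σ v) * (σ α + 1))) =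
      (v ^ 2 + v + 1) * ((u + v) * (v + σ v)) := by
    rw [hv] at hsγ
    rw [hβ', hβ]
    have h2' : ∀ x : K, x + 1 + 1 = x := fun x => by linear_combination h2
    simp only [h2']
    linear_combination (u + v) * (v + σ v) * (hsγ + (v + 1) * h2)
  have h9 : (u + v) * (α + 1) = u * v + u + v := by linear_combination h7 - u * v * h2
  have h10 : (v + σ v) * (σ α + 1) = v * σ v + v + σ v := by
    linear_combination h6 - v * σ v * h2
  rw [h9, h10] at h8
  exact recurrence_identity h2 h8

end FieldAlgebra

end Butterfly

namespace Butterfly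

/-! ### The sesquilinear form and the size of its radical. -/

section Form

variable {K : Type*} [Field K]

/-- The sesquilinear form whose diagonal is the component `(c, d)` of the closed butterfly with
exponent `x ↦ x σ(x)`. -/
def butterflyForm (σ : K →+* K) (α : K) (b p q : K × K) : K :=
  b.1 * ((p.2 + α * p.1) * σ (q.2 + α * q.1) + p.1 * σ q.1) +
    b.2 * ((p.1 + α * p.2) * σ (q.1 + α * q.2) + p.2 * σ q.2)

variable {σ : K →+* K} {α : K} {b : K × K}

theorem butterflyForm_add_left (p p' q : K × K) :
    butterflyForm σ α b (p + p') q = butterflyForm σ α b p q + butterflyForm σ α b p' q := by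
  simp only [butterflyForm, Prod.fst_add, Prod.snd_add]; ring

theorem butterflyForm_add_right (p q q' : K × K) :
    butterflyForm σ α b p (q + q') = butterflyForm σ α b p q + butterflyForm σ α b p q' := by
  simp only [butterflyForm, Prod.fst_add, Prod.snd_add, map_add, map_mul]; ring

theorem butterflyForm_smul_left (l : K) (p q : K × K) :
    butterflyForm σ α b (l • p) q = l * butterflyForm σ α b p q := by
  simp only [butterflyForm, Prod.smul_fst, Prod.smul_snd, smul_eq_mul]; ring

theorem butterflyForm_smul_right (l : K) (p q : K × K) :
    butterflyForm σ α b p (l • q) = σ l * butterflyForm σ α b p q := by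
  simp only [butterflyForm, Prod.smul_fst, Prod.smul_snd, smul_eq_mul, map_add, map_mul]; ring

variable (σ α b) in
/-- The radical of the alternating form `Tr (T(p, q) + T(q, p))`, where `T` is the butterfly
form. -/
def butterflyRadical : AddSubgroup (K × K) where
  carrier := {p | ∀ q, butterflyForm σ α b p q = σ (butterflyForm σ α b q p)}
  zero_mem' q := by simp [butterflyForm]
  add_mem' {p p'} hp hp' q := by
    rw [butterflyForm_add_left, butterflyForm_add_right, map_add, hp q, hp' q]
  neg_mem' {p} hp q := by
    have h1 : -p = (-1 : K) • p := by simp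
    rw [h1, butterflyForm_smul_left, butterflyForm_smul_right, hp q]; simp

theorem mem_butterflyRadical {p : K × K} :
    p ∈ butterflyRadical σ α b ↔ ∀ q, butterflyForm σ α b p q = σ (butterflyForm σ α b q p) :=
  Iff.rfl

theorem butterflyForm_eq_zero_or_one (hσ : ∀ x, σ (σ x) = x → x = 0 ∨ x = 1) {p q : K × K}
    (hp : p ∈ butterflyRadical σ α b) (hq : q ∈ butterflyRadical σ α b) :
    butterflyForm σ α b p q = 0 ∨ butterflyForm σ α b p q = 1 :=
  hσ _ (by rw [← hq p, ← hp q])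

theorem butterflyForm_comm (hσ : ∀ x, σ (σ x) = x → x = 0 ∨ x = 1) {p q : K × K}
    (hp : p ∈ butterflyRadical σ α b) (hq : q ∈ butterflyRadical σ α b) :
    butterflyForm σ α b p q = butterflyForm σ α b q p := by
  rw [hp q]
  rcases butterflyForm_eq_zero_or_one hσ hq hp with h | h <;> simp [h]

variable (σ α b) in
/-- The determinant of the matrix of the butterfly form. -/
def butterflyDet : K :=
  (b.1 * (α * σ α + 1) + b.2) * (b.1 + b.2 * (α * σ α + 1)) -
    (α * b.1 + σ α * b.2) * (σ α * b.1 + α * b.2)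

theorem butterflyForm_eq_row (p q : K × K) : butterflyForm σ α b p q =
    (p.1 * (b.1 * (α * σ α + 1) + b.2) + p.2 * (σ α * b.1 + α * b.2)) * σ q.1 +
      (p.1 * (α * b.1 + σ α * b.2) + p.2 * (b.1 + b.2 * (α * σ α + 1))) * σ q.2 := by
  simp only [butterflyForm, map_add, map_mul]; ring

theorem eq_zero_of_mul_add_mul_eq_zero {a b c d x y : K} (hD : a * d - b * c ≠ 0)
    (h1 : x * a + y * c = 0) (h2 : x * b + y * d = 0) : x = 0 ∧ y = 0 := by
  constructor
  · refine (mul_eq_zero.1 ?_).resolve_left hD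
    linear_combination d * h1 - c * h2
  · refine (mul_eq_zero.1 ?_).resolve_left hD
    linear_combination a * h2 - b * h1

theorem eq_zero_of_forall_butterflyForm_eq_zero (hdet : butterflyDet σ α b ≠ 0) {p : K × K}
    (h : ∀ q, butterflyForm σ α b p q = 0) : p = 0 := by
  have h1 := h (1, 0)
  have h2 := h (0, 1)
  rw [butterflyForm_eq_row] at h1 h2
  simp only [map_one, map_zero, mul_one, mul_zero, add_zero, zero_add] at h1 h2
  have := eq_zero_of_mul_add_mul_eq_zero hdet h1 h2
  exact Prod.ext this.1 this.2

theorem eq_zero_of_butterflyForm_eq_zero (hdet : butterflyDet σ α b ≠ 0) {p p₁ p₂ : K × K}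
    (hD : p₁.1 * p₂.2 - p₂.1 * p₁.2 ≠ 0)
    (h1 : butterflyForm σ α b p p₁ = 0) (h2 : butterflyForm σ α b p p₂ = 0) : p = 0 := by
  refine eq_zero_of_forall_butterflyForm_eq_zero hdet fun q => ?_
  rw [butterflyForm_eq_row] at h1 h2 ⊢
  have hD' := (map_ne_zero σ).2 hD
  rw [map_sub, map_mul, map_mul] at hD'
  have := eq_zero_of_mul_add_mul_eq_zero hD' h1 h2
  rw [this.1, this.2, zero_mul, zero_mul, add_zero]

/-- Two independent radical vectors p₁, p₂ embed the radical in {0, 1}² by p ↦ (T(p, p₁), T(p, p₂)).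
Otherwise it lies on a line K p₁, and l p₁ in the radical forces σ²(l) = l. -/
theorem butterflyRadical_ncard_le_of_det_ne_zero [Finite K]
    (hσ : ∀ x, σ (σ x) = x → x = 0 ∨ x = 1)
    (hdet : butterflyDet σ α b ≠ 0) : (butterflyRadical σ α b : Set (K × K)).ncard ≤ 4 := by
  classical
  by_cases hind : ∃ p₁ ∈ butterflyRadical σ α b, ∃ p₂ ∈ butterflyRadical σ α b,
      p₁.1 * p₂.2 - p₂.1 * p₁.2 ≠ 0
  · obtain ⟨p₁, hp₁, p₂, hp₂, hD⟩ := hind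
    have hle : (butterflyRadical σ α b : Set (K × K)).ncard ≤
        ((({0, 1} : Finset K) ×ˢ ({0, 1} : Finset K) : Finset (K × K)) : Set (K × K)).ncard := by
      refine Set.ncard_le_ncard_of_injOn
        (fun p => (butterflyForm σ α b p p₁, butterflyForm σ α b p p₂)) ?_ ?_ (Set.toFinite _)
      · intro p hp
        simpa using ⟨butterflyForm_eq_zero_or_one hσ hp hp₁, butterflyForm_eq_zero_or_one hσ hp hp₂⟩
      · intro p _ q _ hpq
        simp only [Prod.mk.injEq] at hpq
        have hsub : ∀ r, butterflyForm σ α b (p - q) r =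
            butterflyForm σ α b p r - butterflyForm σ α b q r := fun r => by
          rw [eq_sub_iff_add_eq, ← butterflyForm_add_left, sub_add_cancel]
        refine sub_eq_zero.1 (eq_zero_of_butterflyForm_eq_zero hdet hD ?_ ?_)
        · rw [hsub, hpq.1, sub_self]
        · rw [hsub, hpq.2, sub_self]
    refine hle.trans ?_
    rw [Set.ncard_coe_finset, Finset.card_product]
    exact Nat.mul_le_mul Finset.card_le_two Finset.card_le_two
  · push Not at hind
    by_cases h0 : ∃ p₁ ∈ butterflyRadical σ α b, p₁ ≠ 0
    · obtain ⟨p₁, hp₁, hp₁0⟩ := h0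
      have hsub : (butterflyRadical σ α b : Set (K × K)) ⊆ (({0, p₁} : Finset (K × K)) : Set _) := by
        intro p hp
        obtain ⟨l, rfl⟩ : ∃ l : K, p = l • p₁ := by
          have hD := hind p hp p₁ hp₁
          by_cases hx : p₁.1 = 0
          · have hy : p₁.2 ≠ 0 := fun h => hp₁0 (Prod.ext hx h)
            refine ⟨p.2 / p₁.2, Prod.ext ?_ ?_⟩
            · rw [hx, zero_mul, sub_zero] at hD
              simpa [hx] using (mul_eq_zero.1 hD).resolve_right hy
            · simp [hy]
          · refine ⟨p.1 / p₁.1, Prod.ext ?_ ?_⟩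
            · simp [hx]
            · simp only [Prod.smul_snd, smul_eq_mul]
              field_simp
              linear_combination -hD
        obtain ⟨q, hq⟩ : ∃ q, butterflyForm σ α b p₁ q ≠ 0 := by
          by_contra! h
          exact hp₁0 (eq_zero_of_forall_butterflyForm_eq_zero hdet h)
        have h1 := hp q
        rw [butterflyForm_smul_left, butterflyForm_smul_right, map_mul, ← hp₁ q] at h1
        rcases hσ l (mul_right_cancel₀ hq h1).symm with rfl | rfl <;> simp
      refine (Set.ncard_le_ncard hsub (Set.toFinite _)).trans ?_
      rw [Set.ncard_coe_finset]
      exact Finset.card_le_two.trans (by norm_num)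
    · push Not at h0
      have hsub : (butterflyRadical σ α b : Set (K × K)) ⊆ {0} := fun p hp => h0 p hp
      exact (Set.ncard_le_ncard hsub).trans (by simp)

theorem butterflyRadical_eq_bot_of_det_eq_zero [Finite K] (h2 : (2 : K) = 0)
    (hσ : ∀ x, σ (σ x) = x → x = 0 ∨ x = 1) (hα0 : α ≠ 0) (hα1 : α ≠ 1) (hb : b ≠ 0)
    (hdet : butterflyDet σ α b = 0) : butterflyRadical σ α b = ⊥ := by
  refine (AddSubgroup.eq_bot_iff_forall _).2 fun p hp => ?_
  by_contra hp0
  have hcd : b.1 ≠ 0 ∨ b.2 ≠ 0 := by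
    by_contra! h
    exact hb (Prod.ext h.1 h.2)
  have hr1 := hp (1, 0)
  have hr2 := hp (0, 1)
  simp only [butterflyForm_eq_row, map_one, map_zero, mul_one, mul_zero, add_zero, zero_add,
    one_mul, zero_mul] at hr1 hr2
  rw [butterflyDet] at hdet
  have hkey := @pencil_ne_rank_one K _ _ h2 σ hσ α hα0 hα1 b.1 b.2 hcd
  set n₁₁ := b.1 * (α * σ α + 1) + b.2
  set n₁₂ := α * b.1 + σ α * b.2
  set n₂₁ := σ α * b.1 + α * b.2
  set n₂₂ := b.1 + b.2 * (α * σ α + 1)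
  -- With u = N σ(p), the radical condition reads Nᵀ p = σ(u). If u = 0, then p kills N on the left
  -- and σ(p) on the right, so N is proportional to a σ(a)ᵀ with a = (p₂, p₁). Otherwise the
  -- singular N has column space spanned by u and row space by σ(u), and a = u.
  by_cases hu : n₁₁ * σ p.1 + n₁₂ * σ p.2 = 0 ∧ n₂₁ * σ p.1 + n₂₂ * σ p.2 = 0
  · rw [hu.1, map_zero] at hr1
    rw [hu.2, map_zero] at hr2
    have hp' : p.2 ≠ 0 ∨ p.1 ≠ 0 := by
      by_contra! h
      exact hp0 (Prod.ext h.2 h.1)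
    refine hkey hp' ?_ ?_ ?_ ?_
    · linear_combination hr1 - p.1 * n₁₁ * h2
    · linear_combination hr2 - p.1 * n₁₂ * h2
    · linear_combination hu.1 - σ p.1 * n₁₁ * h2
    · linear_combination hu.2 - σ p.1 * n₂₁ * h2
  · rw [not_and_or] at hu
    refine hkey hu ?_ ?_ ?_ ?_
    · linear_combination -σ p.2 * hdet
    · linear_combination σ p.1 * hdet
    · rw [← hr1, ← hr2]
      linear_combination -p.2 * hdet
    · rw [← hr1, ← hr2]
      linear_combination p.1 * hdet

theorem butterflyRadical_ncard_le [Finite K] (h2 : (2 : K) = 0)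
    (hσ : ∀ x, σ (σ x) = x → x = 0 ∨ x = 1) (hα0 : α ≠ 0) (hα1 : α ≠ 1) (hb : b ≠ 0) :
    (butterflyRadical σ α b : Set (K × K)).ncard ≤ 4 := by
  by_cases hdet : butterflyDet σ α b = 0
  · rw [butterflyRadical_eq_bot_of_det_eq_zero h2 hσ hα0 hα1 hb hdet]
    simp
  · exact butterflyRadical_ncard_le_of_det_ne_zero hσ hdet

/-- A radical with more than two elements contains an isotropic vector. -/
theorem exists_isotropic_of_two_lt_ncard [Finite K] (h2 : (2 : K) = 0)
    (hσ : ∀ x, σ (σ x) = x → x = 0 ∨ x = 1)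
    (hcard : 2 < (butterflyRadical σ α b : Set (K × K)).ncard) :
    ∃ p ≠ 0, butterflyForm σ α b p p = 0 := by
  obtain ⟨x, y, z, hx, hy, hz, hxy, hxz, hyz⟩ :=
    (Set.two_lt_ncard_iff (Set.toFinite _)).1 hcard
  obtain ⟨p, hp, q, hq, hp0, hq0, hpq⟩ : ∃ p ∈ butterflyRadical σ α b,
      ∃ q ∈ butterflyRadical σ α b, p ≠ 0 ∧ q ≠ 0 ∧ p - q ≠ 0 := by
    refine ⟨y - x, sub_mem hy hx, z - x, sub_mem hz hx, sub_ne_zero.2 hxy.symm,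
      sub_ne_zero.2 hxz.symm, ?_⟩
    rw [sub_sub_sub_cancel_right]
    exact sub_ne_zero.2 hyz
  rcases butterflyForm_eq_zero_or_one hσ hp hp with h1 | h1
  · exact ⟨p, hp0, h1⟩
  rcases butterflyForm_eq_zero_or_one hσ hq hq with h3 | h3
  · exact ⟨q, hq0, h3⟩
  -- T is symmetric on the radical, so T(p + q, p + q) = 1 + 1 + 2 T(p, q) = 0.
  refine ⟨p + q, fun h => hpq ?_, ?_⟩
  · have h4 : p - q = (p + q) - (2 : K) • q := by rw [two_smul]; abel
    rw [h4, h2, h, zero_smul, sub_zero]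
  · rw [butterflyForm_add_left, butterflyForm_add_right, butterflyForm_add_right, h1, h3,
      butterflyForm_comm hσ hq hp]
    linear_combination (1 + butterflyForm σ α b p q) * h2

end Form

end Butterfly

namespace Butterfly

/-! ### Semilinear eigenvectors and twisted norms of matrices. -/

section Norm

open Matrix

variable {K : Type*} [Field K] {σ : K →+* K} {α : K}

/-- The product `B σ(B) ⋯ σⁿ⁻¹(B)`. -/
def twistedProd (σ : K →+* K) (B : Matrix (Fin 2) (Fin 2) K) (n : ℕ) : Matrix (Fin 2) (Fin 2) K :=
  (List.ofFn fun j : Fin n => B.map ⇑(σ ^ (j : ℕ))).prod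

theorem twistedProd_succ (B : Matrix (Fin 2) (Fin 2) K) (n : ℕ) :
    twistedProd σ B (n + 1) = twistedProd σ B n * B.map ⇑(σ ^ n) := by
  simp only [twistedProd]
  rw [List.ofFn_succ', List.concat_eq_append, List.prod_append, List.prod_singleton]
  rfl

theorem twistedProd_mulVec {B : Matrix (Fin 2) (Fin 2) K} {w : Fin 2 → K} {l : K}
    (h : B *ᵥ (σ ∘ w) = l • w) (n : ℕ) :
    twistedProd σ B n *ᵥ (⇑(σ ^ n) ∘ w) = (∏ j ∈ Finset.range n, (σ ^ j) l) • w := by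
  induction n with
  | zero => simp [twistedProd]
  | succ n ih =>
    have h1 : B.map ⇑(σ ^ n) *ᵥ (⇑(σ ^ (n + 1)) ∘ w) = (σ ^ n) l • (⇑(σ ^ n) ∘ w) := by
      have h2 : (⇑(σ ^ (n + 1)) ∘ w) = ⇑(σ ^ n) ∘ (σ ∘ w) := by
        ext i; simp [pow_succ]
      rw [h2]
      ext i
      have h3 := congrArg (σ ^ n) (congrFun h i)
      rw [RingHom.map_mulVec] at h3
      rw [h3]
      simp
    rw [twistedProd_succ, ← mulVec_mulVec, h1, mulVec_smul, ih, Finset.prod_range_succ, smul_smul,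
      mul_comm]

theorem det_twistedProd (B : Matrix (Fin 2) (Fin 2) K) (n : ℕ) :
    (twistedProd σ B n).det = ∏ j ∈ Finset.range n, (σ ^ j) B.det := by
  induction n with
  | zero => simp [twistedProd]
  | succ n ih =>
    rw [twistedProd_succ, det_mul, ih, Finset.prod_range_succ, RingHom.map_det]
    rfl

/-- As σ^k = 1, applying σ permutes the factors cyclically; the product is nonzero and fixed, hence
1. -/
theorem prod_range_map_eq_one (hσ : ∀ x, σ (σ x) = x → x = 0 ∨ x = 1) {k : ℕ} (hk : σ ^ k = 1)
    {x : K} (hx : x ≠ 0) : ∏ j ∈ Finset.range k, (σ ^ j) x = 1 := by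
  refine (eq_zero_or_one_of_map_eq hσ ?_).resolve_left
    (Finset.prod_ne_zero_iff.2 fun j _ => (map_ne_zero _).2 hx)
  have h1 : σ (∏ j ∈ Finset.range k, (σ ^ j) x) = ∏ j ∈ Finset.range k, (σ ^ (j + 1)) x := by
    rw [map_prod]
    exact Finset.prod_congr rfl fun j _ => by simp [pow_succ']
  rw [h1]
  have h3 := Finset.prod_range_succ (fun j => (σ ^ j) x) k
  rw [Finset.prod_range_succ', hk] at h3
  simpa [hx] using h3

/-- One eigenvalue is 1 and the determinant is 1, so both eigenvalues are 1 and the trace is 2 = 0.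
-/
theorem trace_eq_zero_of_mulVec_eq (h2 : (2 : K) = 0) {M : Matrix (Fin 2) (Fin 2) K}
    {w : Fin 2 → K} (hw : w ≠ 0) (hM : M *ᵥ w = w) (hdet : M.det = 1) : M.trace = 0 := by
  have h1 : (M - 1).det = 0 := exists_mulVec_eq_zero_iff.1 ⟨w, hw, by
    rw [sub_mulVec, hM, one_mulVec, sub_self]⟩
  rw [det_fin_two] at h1 hdet
  simp at h1
  rw [trace_fin_two]
  linear_combination hdet - h1 + h2

theorem trace_twistedProd_eq_zero (h2 : (2 : K) = 0) (hσ : ∀ x, σ (σ x) = x → x = 0 ∨ x = 1)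
    {k : ℕ} (hk : σ ^ k = 1) {B : Matrix (Fin 2) (Fin 2) K} (hB : B.det ≠ 0) {w : Fin 2 → K}
    (hw : w ≠ 0) {l : K} (h : B *ᵥ (σ ∘ w) = l • w) : (twistedProd σ B k).trace = 0 := by
  have hl : l ≠ 0 := by
    rintro rfl
    rw [zero_smul] at h
    refine hB (exists_mulVec_eq_zero_iff.1 ⟨_, fun h0 => hw ?_, h⟩)
    ext i
    simpa using congrFun h0 i
  refine trace_eq_zero_of_mulVec_eq h2 hw ?_ ?_
  · have h3 := twistedProd_mulVec h k
    rw [prod_range_map_eq_one hσ hk hl, one_smul, hk] at h3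
    exact h3
  · rw [det_twistedProd, prod_range_map_eq_one hσ hk hB]

/-- The trace of a twisted product, as a polynomial in the conjugates of the parameter. -/
theorem trace_twistedProd_add_smul (B C : Matrix (Fin 2) (Fin 2) K) (r : K) (k : ℕ) :
    (twistedProd σ (r • B + C) k).trace = ∑ S : Finset (Fin k), (∏ j ∈ S, (σ ^ (j : ℕ)) r) *
      ((List.ofFn (S.piecewise (fun j => B.map ⇑(σ ^ (j : ℕ)))
        (fun j => C.map ⇑(σ ^ (j : ℕ))))).prod).trace := by
  let L := (traceLinearMap (Fin 2) K K).compMultilinearMap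
    (MultilinearMap.mkPiAlgebraFin K k (Matrix (Fin 2) (Fin 2) K))
  have hL : ∀ m, L m = ((List.ofFn m).prod).trace := fun m => rfl
  have h1 : (twistedProd σ (r • B + C) k).trace =
      L ((fun j : Fin k => (σ ^ (j : ℕ)) r • B.map ⇑(σ ^ (j : ℕ))) + fun j : Fin k => C.map ⇑(σ ^ (j : ℕ))) := by
    rw [hL, twistedProd]
    congr 3
    ext j : 1
    ext a b
    simp
  rw [h1, L.map_add_univ]
  refine Finset.sum_congr rfl fun S _ => ?_
  rw [← hL, ← smul_eq_mul, ← L.map_piecewise_smul]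
  congr 1
  ext j : 1
  by_cases hj : j ∈ S <;> simp [hj]

/-- Distinct products of conjugates being linearly independent functions, a trace of twisted
products that vanishes identically vanishes coefficientwise. -/
theorem trace_piecewise_eq_zero {k : ℕ}
    (hχ : Function.Injective fun S : Finset (Fin k) =>
      ∏ j ∈ S, ((σ ^ (j : ℕ) : K →+* K) : K →* K))
    {B C : Matrix (Fin 2) (Fin 2) K} (h : ∀ r : K, (twistedProd σ (r • B + C) k).trace = 0)
    (S : Finset (Fin k)) :
    ((List.ofFn (S.piecewise (fun j => B.map ⇑(σ ^ (j : ℕ)))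
      (fun j => C.map ⇑(σ ^ (j : ℕ))))).prod).trace = 0 := by
  have hli := (linearIndependent_monoidHom K K).comp _ hχ
  refine Fintype.linearIndependent_iff.1 hli (fun S => ((List.ofFn (S.piecewise
    (fun j => B.map ⇑(σ ^ (j : ℕ))) (fun j => C.map ⇑(σ ^ (j : ℕ))))).prod).trace) ?_ S
  ext r
  have h1 := h r
  rw [trace_twistedProd_add_smul] at h1
  simp only [Finset.sum_apply, Pi.smul_apply, Function.comp_apply, smul_eq_mul, Pi.zero_apply]
  rw [← h1]
  refine Finset.sum_congr rfl fun S _ => ?_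
  rw [mul_comm, MonoidHom.finsetProd_apply]
  rfl

/-- The all-ones matrix squares to zero, so the factors 1 + ρE multiply by adding the ρ. -/
theorem prod_ofFn_smul_one_add (h2 : (2 : K) = 0) (n : ℕ) (g ρ : Fin n → K) :
    (List.ofFn fun j => g j • (1 + ρ j • !![1, 1; 1, 1] : Matrix (Fin 2) (Fin 2) K)).prod =
      (∏ j, g j) • (1 + (∑ j, ρ j) • !![1, 1; 1, 1]) := by
  induction n with
  | zero => simp
  | succ n ih =>
    have hE : (!![1, 1; 1, 1] * !![1, 1; 1, 1] : Matrix (Fin 2) (Fin 2) K) = 0 := by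
      ext i j
      fin_cases i <;> fin_cases j <;> simp <;> linear_combination h2
    rw [List.ofFn_succ, List.prod_cons, ih, Fin.prod_univ_succ, Fin.sum_univ_succ,
      smul_mul_smul_comm, add_mul, mul_add, mul_add, smul_mul_smul_comm, hE]
    simp only [one_mul, mul_one, smul_zero, add_zero, add_smul]
    congr 1
    abel

variable (σ α) in
/-- The member of the pencil of butterfly matrices that is rotated by the exchange matrix. -/
def pencilBase : Matrix (Fin 2) (Fin 2) K := !![σ α, 1; α * σ α + 1, α]

variable (σ α) in
/-- The direction of the pencil that commutes with the exchange matrix. -/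
def pencilShift : Matrix (Fin 2) (Fin 2) K :=
  !![α + σ α, α * σ α; α * σ α, α + σ α]

theorem det_pencil (h2 : (2 : K) = 0) (r : K) :
    (r • pencilBase σ α + pencilShift σ α).det = butterflyDet σ α (1 + r, 1) := by
  rw [det_fin_two, butterflyDet]
  simp [pencilBase, pencilShift]
  grind

/-- The pencil member is N with its rows exchanged. In characteristic 2, pᵀ N σ(p) = 0 says exactly
that the exchanged vector N σ(p) is parallel to p. -/
theorem exists_mulVec_eq_smul (h2 : (2 : K) = 0) {r : K} {p : K × K} (hp : p ≠ 0)
    (h : butterflyForm σ α (1 + r, 1) p p = 0) :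
    ∃ l : K, (r • pencilBase σ α + pencilShift σ α) *ᵥ (σ ∘ ![p.1, p.2]) = l • ![p.1, p.2] := by
  obtain ⟨u₁, hu₁⟩ : ∃ u, u = (r * σ α + (α + σ α)) * σ p.1 + (r + α * σ α) * σ p.2 := ⟨_, rfl⟩
  obtain ⟨u₂, hu₂⟩ : ∃ u, u = (r * (α * σ α + 1) + α * σ α) * σ p.1 +
    (r * α + (α + σ α)) * σ p.2 := ⟨_, rfl⟩
  have hu : p.2 * u₁ = p.1 * u₂ := by
    rw [butterflyForm_eq_row] at h
    simp only at h
    rw [hu₁, hu₂]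
    generalize σ p.1 = a at *
    generalize σ p.2 = b at *
    generalize σ α = c at *
    clear hp hu₁ hu₂
    grind
  have hB : (r • pencilBase σ α + pencilShift σ α) *ᵥ (σ ∘ ![p.1, p.2]) = ![u₁, u₂] := by
    ext i
    fin_cases i <;> simp [pencilBase, pencilShift, mulVec, dotProduct, Fin.sum_univ_two, hu₁, hu₂]
  rw [hB]
  by_cases hx : p.1 = 0
  · have hy : p.2 ≠ 0 := fun hy => hp (Prod.ext hx hy)
    have hu0 : u₁ = 0 := by simpa [hx, hy] using hu
    exact ⟨u₂ / p.2, by ext i; fin_cases i <;> simp [hx, hy, hu0]⟩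
  · refine ⟨u₁ / p.1, ?_⟩
    ext i
    fin_cases i
    · simp [hx]
    · simp only [Fin.mk_one, cons_val_one, cons_val_fin_one, Pi.smul_apply, smul_eq_mul]
      field_simp
      linear_combination -hu

theorem add_mul_add_ne_zero (hσ : ∀ x, σ (σ x) = x → x = 0 ∨ x = 1)
    (hα0 : α ≠ 0) : α + σ α + α * σ α ≠ 0 := fun h => hα0 <| by
  have h1 : (α + 1) * σ (α + 1) = 1 := by
    rw [map_add, map_one]
    linear_combination h
  linear_combination eq_one_of_mul_map_eq_one hσ h1

theorem map_pencilShift (h2 : (2 : K) = 0) (hg : α + σ α + α * σ α ≠ 0) (τ : K →+* K) :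
    (pencilShift σ α).map τ = τ (α + σ α + α * σ α) •
      (1 + τ (α * σ α / (α + σ α + α * σ α)) • !![1, 1; 1, 1]) := by
  have hg' := (map_ne_zero τ).2 hg
  ext i j
  rw [map_div₀]
  set g := α + σ α + α * σ α with hgdef
  have hb : τ g * (τ (α * σ α) / τ g) = τ (α * σ α) := by field_simp
  have ha : τ g + τ (α * σ α) = τ (α + σ α) := by
    rw [← map_add, hgdef]
    congr 1
    linear_combination (α * σ α) * h2
  fin_cases i <;> fin_cases j <;> simp [pencilShift, mul_add, -map_mul, -map_add, hb, ha]

theorem trace_pencilBase_mul (h2 : (2 : K) = 0) (v : K) :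
    (pencilBase σ α * ((pencilBase σ α).map σ * (1 + v • !![1, 1; 1, 1] : Matrix (Fin 2) (Fin 2) K))).trace =
      v * (α + σ (σ α)) := by
  rw [trace_fin_two]
  simp [pencilBase, mul_apply, Fin.sum_univ_two]
  generalize σ (σ α) = c
  generalize σ α = b
  grind

theorem exists_trace_twistedProd_ne_zero (h2 : (2 : K) = 0)
    (hσ : ∀ x, σ (σ x) = x → x = 0 ∨ x = 1) (hα0 : α ≠ 0) (hα1 : α ≠ 1) {n : ℕ}
    (hn : Odd n) (hk : σ ^ (n + 2) = 1)
    (hχ : Function.Injective fun S : Finset (Fin (n + 2)) =>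
      ∏ j ∈ S, ((σ ^ (j : ℕ) : K →+* K) : K →* K)) :
    ∃ r : K, (twistedProd σ (r • pencilBase σ α + pencilShift σ α) (n + 2)).trace ≠ 0 := by
  by_contra! h
  have hg := add_mul_add_ne_zero hσ hα0
  set g := α + σ α + α * σ α with hgdef
  set ρ := α * σ α / g with hρ
  -- For S = {0, 1} all factors from index 2 on are shift matrices, which commute and multiply
  -- explicitly. The coefficient is a nonzero multiple of (α + σ²(α)) Σ σ^j(ρ) over 2 ≤ j < n + 2.
  have h1 := trace_piecewise_eq_zero hχ h {0, 1}
  rw [List.ofFn_succ, List.ofFn_succ, List.prod_cons, List.prod_cons] at h1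
  have htail : (fun i : Fin n => (({0, 1} : Finset (Fin (n + 2))).piecewise
      (fun j => (pencilBase σ α).map ⇑(σ ^ (j : ℕ)))
      (fun j => (pencilShift σ α).map ⇑(σ ^ (j : ℕ)))) i.succ.succ) =
      fun i : Fin n => (σ ^ ((i : ℕ) + 2)) g •
        (1 + (σ ^ ((i : ℕ) + 2)) ρ • !![1, 1; 1, 1] : Matrix (Fin 2) (Fin 2) K) := by
    funext i
    rw [Finset.piecewise_eq_of_notMem, map_pencilShift h2 hg]
    · rfl
    · simp [Fin.ext_iff]
  rw [htail, prod_ofFn_smul_one_add h2] at h1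
  rw [Finset.piecewise_eq_of_mem _ _ _ (by simp), Finset.piecewise_eq_of_mem _ _ _ (by simp),
    mul_smul_comm, mul_smul_comm, trace_smul, smul_eq_mul] at h1
  have hG : ∏ j : Fin n, (σ ^ ((j : ℕ) + 2)) g ≠ 0 :=
    Finset.prod_ne_zero_iff.2 fun j _ => (map_ne_zero _).2 hg
  replace h1 := (mul_eq_zero.1 h1).resolve_left hG
  have e0 : (pencilBase σ α).map ⇑(σ ^ (((0 : Fin (n + 2)) : ℕ))) = pencilBase σ α := by
    ext; simp
  have e1 : (pencilBase σ α).map ⇑(σ ^ (((Fin.succ 0 : Fin (n + 2)) : ℕ))) =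
      (pencilBase σ α).map σ := by
    ext; simp
  rw [e0, e1, trace_pencilBase_mul h2] at h1
  have hα : α + σ (σ α) ≠ 0 := fun h3 => by
    rcases hσ α (by linear_combination h3 - α * h2) with h4 | h4
    exacts [hα0 h4, hα1 h4]
  replace h1 := (mul_eq_zero.1 h1).resolve_right hα
  rw [Fin.sum_univ_eq_sum_range (fun j => (σ ^ (j + 2)) ρ)] at h1
  -- Subtracting the vanishing sum from its image under σ telescopes to σ²(ρ) = σ^(n+2)(ρ) = ρ.
  have h3 := Finset.sum_range_succ (fun j => (σ ^ (j + 2)) ρ) n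
  rw [Finset.sum_range_succ', h1, hk] at h3
  have h4 : ∑ j ∈ Finset.range n, (σ ^ (j + 1 + 2)) ρ = 0 := by
    rw [← map_zero σ, ← h1, map_sum]
    exact Finset.sum_congr rfl fun j _ => by simp [pow_succ']
  rw [h4] at h3
  have h5 : σ (σ ρ) = ρ := by simpa [pow_succ] using h3
  rcases hσ ρ h5 with h6 | h6
  · rw [hρ, div_eq_zero_iff] at h6
    simp [hg, hα0] at h6
  -- If ρ = 1, the sum has n terms equal to 1, and n is odd.
  · obtain ⟨m, rfl⟩ := hn
    rw [h6] at h1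
    simp only [map_one, Finset.sum_const, Finset.card_range, nsmul_eq_mul, mul_one] at h1
    push_cast at h1
    exact one_ne_zero (α := K) (by linear_combination h1 - m * h2)

/-- Some nonzero component of the butterfly has a radical with at most two elements. -/
theorem exists_butterflyRadical_ncard_le_two [Finite K] (h2 : (2 : K) = 0)
    (hσ : ∀ x, σ (σ x) = x → x = 0 ∨ x = 1) (hα0 : α ≠ 0) (hα1 : α ≠ 1) {n : ℕ}
    (hn : Odd n) (hk : σ ^ (n + 2) = 1)
    (hχ : Function.Injective fun S : Finset (Fin (n + 2)) =>
      ∏ j ∈ S, ((σ ^ (j : ℕ) : K →+* K) : K →* K)) :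
    ∃ b : K × K, b ≠ 0 ∧ (butterflyRadical σ α b : Set (K × K)).ncard ≤ 2 := by
  obtain ⟨r, hr⟩ := exists_trace_twistedProd_ne_zero h2 hσ hα0 hα1 hn hk hχ
  have hb : ((1 + r, 1) : K × K) ≠ 0 := fun h => one_ne_zero (congrArg Prod.snd h)
  refine ⟨(1 + r, 1), hb, ?_⟩
  by_contra! hcard
  obtain ⟨p, hp0, hp⟩ := exists_isotropic_of_two_lt_ncard h2 hσ hcard
  have hdet : butterflyDet σ α (1 + r, 1) ≠ 0 := fun h => by
    rw [butterflyRadical_eq_bot_of_det_eq_zero h2 hσ hα0 hα1 hb h] at hcard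
    simp at hcard
  obtain ⟨l, hl⟩ := exists_mulVec_eq_smul h2 hp0 hp
  refine hr (trace_twistedProd_eq_zero h2 hσ hk (by rwa [det_pencil h2]) (fun h => hp0 ?_) hl)
  exact Prod.ext (by simpa using congrFun h 0) (by simpa using congrFun h 1)

end Norm

end Butterfly

namespace Butterfly

/-! ### Exponential sums of quadratic functions and Walsh moments. -/

section Sums

/-- The sign `(-1) ^ z`. -/
def sign (z : ZMod 2) : ℤ := (-1) ^ z.val

theorem sign_zero : sign 0 = 1 := rfl

theorem sign_add (a b : ZMod 2) : sign (a + b) = sign a * sign b := by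
  revert a b; decide

theorem sum_sign_addMonoidHom_eq_zero {H : Type*} [AddCommGroup H] [Fintype H] {φ : H →+ ZMod 2}
    (hφ : φ ≠ 0) : ∑ h, sign (φ h) = 0 := by
  obtain ⟨x, hx⟩ := DFunLike.ne_iff.1 hφ
  have hx1 : φ x = 1 := by
    have : ∀ z : ZMod 2, z ≠ 0 → z = 1 := by decide
    exact this _ hx
  have h1 : ∑ h, sign (φ h) = ∑ h, sign (φ (x + h)) :=
    (Equiv.sum_comp (Equiv.addLeft x) fun h => sign (φ h)).symm
  simp only [map_add, hx1, sign_add, ← Finset.mul_sum] at h1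
  have h3 : sign 1 = -1 := rfl
  rw [h3] at h1
  linarith

theorem sum_sign_zero {H : Type*} [AddCommGroup H] [Fintype H] :
    ∑ h, sign ((0 : H →+ ZMod 2) h) = Fintype.card H := by
  simp [sign_zero]

/-- The square of the exponential sum of a quadratic function is governed by its radical. -/
theorem sq_sum_sign_eq {G : Type*} [AddCommGroup G] [Fintype G] {g : G → ZMod 2}
    {B : G → G →+ ZMod 2} (hg : ∀ x u, g (x + u) = g x + g u + B u x) (R : AddSubgroup G)
    (hR : ∀ u, u ∈ R ↔ B u = 0) :
    (∑ x, sign (g x)) ^ 2 = 0 ∨ (∑ x, sign (g x)) ^ 2 = Fintype.card G * Nat.card R := by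
  classical
  have h1 : (∑ x, sign (g x)) ^ 2 = ∑ u, sign (g u) * ∑ x, sign (B u x) := by
    calc (∑ x, sign (g x)) ^ 2 = ∑ x, ∑ u, sign (g x) * sign (g (x + u)) := by
          rw [sq, Finset.sum_mul_sum]
          exact Finset.sum_congr rfl fun x _ =>
            (Equiv.sum_comp (Equiv.addLeft x) fun y => sign (g x) * sign (g y)).symm
      _ = ∑ u, sign (g u) * ∑ x, sign (B u x) := by
          rw [Finset.sum_comm]
          refine Finset.sum_congr rfl fun u _ => ?_
          rw [Finset.mul_sum]
          refine Finset.sum_congr rfl fun x _ => ?_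
          rw [hg, ← sign_add, ← sign_add, ← add_assoc, ← add_assoc, CharTwo.add_self_eq_zero,
            zero_add]
  have h3 : ∀ u, sign (g u) * ∑ x, sign (B u x) =
      if u ∈ R then sign (g u) * Fintype.card G else 0 := by
    intro u
    split_ifs with hu
    · rw [(hR u).1 hu, sum_sign_zero]
    · rw [sum_sign_addMonoidHom_eq_zero (fun h => hu ((hR u).2 h)), mul_zero]
  simp only [h1, h3]
  rw [← Finset.sum_filter, ← Finset.sum_mul]
  -- On the radical g is a homomorphism to 𝔽₂, so its sign sum is |R| or 0.
  have hadd : ∀ x ∈ R, ∀ y ∈ R, g (x + y) = g x + g y := fun x _ y hy => by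
    rw [hg, (hR y).1 hy, AddMonoidHom.zero_apply, add_zero]
  let φ : R →+ ZMod 2 := AddMonoidHom.mk' (fun u => g u) fun x y => hadd x x.2 y y.2
  have h4 : ∑ u with u ∈ R, sign (g u) = ∑ u : R, sign (φ u) :=
    Finset.sum_subtype _ (by simp) _
  rw [h4]
  by_cases hφ : φ = 0
  · right
    rw [hφ, sum_sign_zero, Nat.card_eq_fintype_card, mul_comm]
  · left
    rw [sum_sign_addMonoidHom_eq_zero hφ, zero_mul]

variable {K : Type*} [Field K] [Algebra (ZMod 2) K]

/-- The linear functional attached to `x` by the trace form on `K × K`. -/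
noncomputable def traceFunctional (x : K × K) : K × K →+ ZMod 2 :=
  AddMonoidHom.mk' (fun a => Algebra.trace (ZMod 2) K (a.1 * x.1 + a.2 * x.2)) fun a b => by
    rw [← map_add]
    congr 1
    simp only [Prod.fst_add, Prod.snd_add]
    ring

theorem traceFunctional_apply (x a : K × K) :
    traceFunctional x a = Algebra.trace (ZMod 2) K (a.1 * x.1 + a.2 * x.2) := rfl

theorem traceFunctional_comm (x a : K × K) : traceFunctional x a = traceFunctional a x := by
  simp only [traceFunctional_apply, mul_comm]

theorem eq_zero_of_trace_mul_eq_zero [Finite K] {x : K}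
    (h : ∀ l, Algebra.trace (ZMod 2) K (l * x) = 0) : x = 0 :=
  (traceForm_nondegenerate (ZMod 2) K).2 x fun l => by
    rw [Algebra.traceForm_apply, h]

theorem traceFunctional_ne_zero [Finite K] {x : K × K} (hx : x ≠ 0) : traceFunctional x ≠ 0 := by
  intro h
  refine hx (Prod.ext (eq_zero_of_trace_mul_eq_zero fun l => ?_)
    (eq_zero_of_trace_mul_eq_zero fun l => ?_))
  · simpa [traceFunctional_apply] using DFunLike.congr_fun h (l, 0)
  · simpa [traceFunctional_apply] using DFunLike.congr_fun h (0, l)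

variable [Fintype K]

theorem sum_sign_traceFunctional [DecidableEq K] (x : K × K) :
    ∑ a, sign (traceFunctional x a) = if x = 0 then (Fintype.card (K × K) : ℤ) else 0 := by
  split_ifs with hx
  · have : traceFunctional (0 : K × K) = 0 := by
      ext a; all_goals simp [traceFunctional_apply]
    rw [hx, this, sum_sign_zero]
  · exact sum_sign_addMonoidHom_eq_zero (traceFunctional_ne_zero hx)

/-- The first moment of a Walsh transform. -/
theorem sum_walsh_eq (f : K × K → ZMod 2) :
    ∑ a, ∑ x, sign (f x + traceFunctional a x) = sign (f 0) * Fintype.card (K × K) := by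
  classical
  rw [Finset.sum_comm]
  simp only [sign_add, ← Finset.mul_sum, traceFunctional_comm _, sum_sign_traceFunctional]
  simp

/-- The second moment of a Walsh transform. -/
theorem sum_sq_walsh_eq (f : K × K → ZMod 2) :
    ∑ a, (∑ x, sign (f x + traceFunctional a x)) ^ 2 = (Fintype.card (K × K) : ℤ) ^ 2 := by
  classical
  have hneg : ∀ x : K × K, -x = x := fun x => by
    have : CharP K 2 := charP_of_injective_algebraMap (algebraMap (ZMod 2) K).injective 2
    exact Prod.ext (CharTwo.neg_eq _) (CharTwo.neg_eq _)
  have h1 : ∀ a : K × K, (∑ x, sign (f x + traceFunctional a x)) ^ 2 =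
      ∑ x, ∑ y, sign (f x + f y) * sign (traceFunctional (x + y) a) := fun a => by
    rw [sq, Finset.sum_mul_sum]
    refine Finset.sum_congr rfl fun x _ => Finset.sum_congr rfl fun y _ => ?_
    rw [traceFunctional_comm (x + y), map_add]
    simp only [sign_add]
    ring
  simp only [h1]
  rw [Finset.sum_comm]
  have h3 : ∀ x : K × K, ∑ a, ∑ y, sign (f x + f y) * sign (traceFunctional (x + y) a) =
      Fintype.card (K × K) := fun x => by
    rw [Finset.sum_comm]
    simp only [← Finset.mul_sum, sum_sign_traceFunctional]
    rw [Finset.sum_eq_single x]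
    · have h0 : x + x = 0 := by nth_rewrite 1 [← hneg x]; exact neg_add_cancel x
      rw [h0, if_pos rfl, CharTwo.add_self_eq_zero, sign_zero, one_mul]
    · intro y _ hy
      rw [if_neg, mul_zero]
      intro h0
      exact hy (by rw [← hneg x]; exact eq_neg_of_add_eq_zero_right h0)
    · simp
  rw [Finset.sum_congr rfl fun x _ => h3 x]
  simp [sq]

end Sums

/-! ### Values forced by the moments. -/

section Plateaued

variable {ι : Type*} [Fintype ι] {W : ι → ℤ} {N R : ℤ}

/-- If R or -R is omitted, W² is a constant multiple of W, and the moments give N = -R or N = R. -/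
theorem exists_eq_and_exists_eq_neg (hN : 0 < N) (hR : 0 < R)
    (hW : ∀ a, W a = 0 ∨ W a = R ∨ W a = -R)
    (h1 : ∑ a, W a = N) (h2 : ∑ a, W a ^ 2 = N ^ 2) (hNR : N ≠ R) :
    (∃ a, W a = R) ∧ ∃ a, W a = -R := by
  constructor
  · by_contra! h
    have h3 : ∑ a, W a ^ 2 = -R * N := by
      rw [← h1, Finset.mul_sum]
      refine Finset.sum_congr rfl fun a _ => ?_
      rcases hW a with h0 | h0 | h0
      · rw [h0]; ring
      · exact absurd h0 (h a)
      · rw [h0]; ring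
    nlinarith
  · by_contra! h
    have h3 : ∑ a, W a ^ 2 = R * N := by
      rw [← h1, Finset.mul_sum]
      refine Finset.sum_congr rfl fun a _ => ?_
      rcases hW a with h0 | h0 | h0
      · rw [h0]; ring
      · rw [h0]; ring
      · exact absurd h0 (h a)
    rw [h2, sq] at h3
    exact hNR (mul_right_cancel₀ hN.ne' h3)

theorem exists_eq_zero_of_plateaued (hN : 0 < N) (hW : ∀ a, W a = 0 ∨ W a = R ∨ W a = -R)
    (hcard : (Fintype.card ι : ℤ) = N) (h2 : ∑ a, W a ^ 2 = N ^ 2) (hNR : N ≠ R ^ 2) :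
    ∃ a, W a = 0 := by
  by_contra! h
  have h3 : ∑ a, W a ^ 2 = N * R ^ 2 := by
    rw [← hcard, ← Finset.card_univ, ← nsmul_eq_mul]
    refine Finset.sum_eq_card_nsmul fun a _ => ?_
    rcases hW a with h0 | h0 | h0
    · exact absurd h0 (h a)
    · rw [h0]
    · rw [h0]; ring
  rw [h2, sq] at h3
  exact hNR (mul_left_cancel₀ hN.ne' h3)

/-- If w² ≠ 0, then m is a nonzero square at most 4, so m is 1 or 4. The ranges may overlap at m =
2, where w = 0. -/
theorem plateaued_values {w : ℤ} {k m : ℕ} (h : w ^ 2 = 0 ∨ w ^ 2 = 2 ^ (2 * k) * m) (hm : m ≤ 4) :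
    (m ≤ 2 → w = 0 ∨ w = 2 ^ k ∨ w = -2 ^ k) ∧
      (2 ≤ m → w = 0 ∨ w = 2 ^ (k + 1) ∨ w = -2 ^ (k + 1)) := by
  rcases h with h | h
  · rw [pow_eq_zero_iff two_ne_zero] at h
    exact ⟨fun _ => Or.inl h, fun _ => Or.inl h⟩
  · have hdvd : (2 ^ k : ℤ) ∣ w := by
      rw [← Int.pow_dvd_pow_iff two_ne_zero, h, ← pow_mul, mul_comm k]
      exact dvd_mul_right _ _
    obtain ⟨v, rfl⟩ := hdvd
    have hv : v ^ 2 = m := by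
      refine mul_left_cancel₀ (pow_ne_zero (2 * k) (two_ne_zero : (2 : ℤ) ≠ 0)) ?_
      rw [← h]; ring
    have hv4 : v ^ 2 ≤ 4 := by rw [hv]; exact_mod_cast hm
    have hv1 : v ≤ 2 := by nlinarith
    have hv2 : -2 ≤ v := by nlinarith
    interval_cases v
    · exact ⟨fun h3 => by omega, fun _ => Or.inr (Or.inr (by ring))⟩
    · exact ⟨fun _ => Or.inr (Or.inr (by ring)), fun h3 => by omega⟩
    · exact ⟨fun _ => Or.inl (by ring), fun h3 => by omega⟩
    · exact ⟨fun _ => Or.inr (Or.inl (by ring)), fun h3 => by omega⟩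
    · exact ⟨fun h3 => by omega, fun _ => Or.inr (Or.inl (by ring))⟩

end Plateaued

end Butterfly

namespace Butterfly

/-! ### Powers of the Frobenius map. -/

section Frobenius

variable {K : Type*} [Field K] {k i : ℕ}

theorem iterateFrobenius_pow_apply [CharP K 2] (j : ℕ) (x : K) :
    (iterateFrobenius K 2 i ^ j) x = x ^ 2 ^ (i * j) := by
  induction j with
  | zero => simp
  | succ j ih =>
    rw [pow_succ', RingHom.mul_def, RingHom.comp_apply, ih, iterateFrobenius_def, ← pow_mul,
      ← pow_add, mul_add, mul_one]

variable [Fintype K]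

theorem pow_two_pow_mod (hK : Fintype.card K = 2 ^ k) (x : K) (m : ℕ) :
    x ^ 2 ^ m = x ^ 2 ^ (m % k) := by
  conv_lhs => rw [← Nat.mod_add_div m k, pow_add, pow_mul, pow_mul, ← hK,
    FiniteField.pow_card_pow]

variable [CharP K 2]

theorem iterateFrobenius_pow_eq_one (hK : Fintype.card K = 2 ^ k) :
    iterateFrobenius K 2 i ^ k = 1 := by
  ext x
  rw [iterateFrobenius_pow_apply, mul_comm, pow_mul, ← hK, FiniteField.pow_card_pow]
  rfl

theorem eq_zero_or_one_of_iterateFrobenius_sq (hK : Fintype.card K = 2 ^ k) (hk : Odd k)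
    (hi : Nat.gcd i k = 1) (x : K)
    (hx : iterateFrobenius K 2 i (iterateFrobenius K 2 i x) = x) : x = 0 ∨ x = 1 := by
  have h1 : Function.IsPeriodicPt (fun y : K => y ^ 2) (2 * i) x := by
    rw [Function.IsPeriodicPt, Function.IsFixedPt, pow_iterate]
    simpa [iterateFrobenius_def, ← pow_mul, ← pow_add, two_mul] using hx
  have h2 : Function.IsPeriodicPt (fun y : K => y ^ 2) k x := by
    rw [Function.IsPeriodicPt, Function.IsFixedPt, pow_iterate]
    change x ^ 2 ^ k = x
    rw [← hK, FiniteField.pow_card]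
  have h3 := h1.gcd h2
  rw [Nat.Coprime.mul_left (Nat.coprime_two_left.2 hk) hi] at h3
  have h4 : x ^ 2 = x := h3
  have h5 : x * (x - 1) = 0 := by linear_combination h4
  rcases mul_eq_zero.1 h5 with h | h
  exacts [Or.inl h, Or.inr (sub_eq_zero.1 h)]

/-- Distinct products of conjugates of the Frobenius automorphism are distinct functions. -/
theorem prod_iterateFrobenius_injective (hK : Fintype.card K = 2 ^ k) (hi : Nat.gcd i k = 1) :
    Function.Injective fun S : Finset (Fin k) =>
      ∏ j ∈ S, ((iterateFrobenius K 2 i ^ (j : ℕ) : K →+* K) : K →* K) := by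
  classical
  -- The product over S is x ↦ x^m, where m has binary digits at the positions ij mod k, distinct
  -- for distinct j.
  let f : Fin k → ℕ := fun j => i * j % k
  have hf : Function.Injective f := fun a b hab => by
    have h1 : (a : ℕ) ≡ b [MOD k] :=
      Nat.ModEq.cancel_left_of_coprime (by rwa [Nat.gcd_comm]) hab
    exact Fin.ext (h1.eq_of_lt_of_lt a.2 b.2)
  have happ : ∀ (S : Finset (Fin k)) (x : K),
      (∏ j ∈ S, ((iterateFrobenius K 2 i ^ (j : ℕ) : K →+* K) : K →* K)) x =
        x ^ ∑ m ∈ S.image f, 2 ^ m := fun S x => by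
    rw [MonoidHom.finsetProd_apply, Finset.sum_image hf.injOn, ← Finset.prod_pow_eq_pow_sum]
    refine Finset.prod_congr rfl fun j _ => ?_
    rw [← pow_two_pow_mod hK, ← iterateFrobenius_pow_apply]
    rfl
  have hpos : ∀ S : Finset (Fin k), S ≠ ∅ → 0 < ∑ m ∈ S.image f, 2 ^ m := fun S hS =>
    Finset.sum_pos (fun _ _ => by positivity)
      ((Finset.nonempty_iff_ne_empty.2 hS).image f)
  have hlt : ∀ S : Finset (Fin k), ∑ m ∈ S.image f, 2 ^ m < 2 ^ k := fun S =>
    Nat.geomSum_lt le_rfl fun m hm => by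
      obtain ⟨j, _, rfl⟩ := Finset.mem_image.1 hm
      exact Nat.mod_lt _ j.pos
  intro S S' h
  have hx : ∀ x : K, x ^ (∑ m ∈ S.image f, 2 ^ m) = x ^ ∑ m ∈ S'.image f, 2 ^ m := fun x => by
    rw [← happ, ← happ]
    exact DFunLike.congr_fun h x
  have hsum : ∑ m ∈ S.image f, 2 ^ m = ∑ m ∈ S'.image f, 2 ^ m := by
    -- A generator of Kˣ determines exponents only modulo 2^k - 1; evaluation at 0 separates the
    -- exponent 0 from 2^k - 1.
    by_cases hS : S = ∅
    · by_cases hS' : S' = ∅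
      · rw [hS, hS']
      · have := hx 0
        rw [zero_pow (hpos S' hS').ne', hS] at this
        simp at this
    by_cases hS' : S' = ∅
    · have := hx 0
      rw [zero_pow (hpos S hS).ne', hS'] at this
      simp at this
    obtain ⟨g, hg⟩ := IsCyclic.exists_generator (α := Kˣ)
    have hord : orderOf g = 2 ^ k - 1 := by
      rw [orderOf_eq_card_of_forall_mem_zpowers hg, Nat.card_eq_fintype_card, Fintype.card_units,
        hK]
    have h1 : g ^ (∑ m ∈ S.image f, 2 ^ m) = g ^ ∑ m ∈ S'.image f, 2 ^ m :=
      Units.ext (by simpa using hx g)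
    rw [pow_eq_pow_iff_modEq, hord] at h1
    have hp := hpos S hS
    have hp' := hpos S' hS'
    have hl := hlt S
    have hl' := hlt S'
    generalize ∑ m ∈ S.image f, 2 ^ m = a at *
    generalize ∑ m ∈ S'.image f, 2 ^ m = b at *
    -- Exponents in 1, …, 2^k - 1 are lowered by one to lie below the modulus.
    obtain ⟨a, rfl⟩ := Nat.exists_eq_add_of_le' hp
    obtain ⟨b, rfl⟩ := Nat.exists_eq_add_of_le' hp'
    rw [(Nat.ModEq.add_right_cancel' 1 h1).eq_of_lt_of_lt (by omega) (by omega)]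
  exact Finset.image_injective hf (Finset.geomSum_injective le_rfl hsum)

theorem trace_iterateFrobenius [Algebra (ZMod 2) K] (n : ℕ) (x : K) :
    Algebra.trace (ZMod 2) K (iterateFrobenius K 2 n x) = Algebra.trace (ZMod 2) K x := by
  rw [iterateFrobenius_def]
  induction n with
  | zero => simp
  | succ n ih =>
    rw [← ih, pow_succ, pow_mul]
    have := Algebra.trace_eq_of_algEquiv
      (FiniteField.frobeniusAlgEquivOfAlgebraic (ZMod 2) K) (x ^ 2 ^ n)
    simpa [ZMod.card] using this

end Frobenius

end Butterfly

namespace Butterfly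

/-! ### Components as quadratic functions. -/

section Polarization

variable {K : Type*} [Field K] [CharP K 2] {i : ℕ} {α : K}

theorem keyedPerm_eq_map (t : ℕ) (z x : K) : keyedPerm ((2 ^ i + 1) * 2 ^ t) α z x =
    iterateFrobenius K 2 t ((x + α * z) * iterateFrobenius K 2 i (x + α * z) +
      z * iterateFrobenius K 2 i z) := by
  rw [map_add, keyedPerm]
  simp only [iterateFrobenius_def, ← pow_succ', ← pow_mul]

variable [Algebra (ZMod 2) K]

variable (i α) in
/-- The polarization of a component of the butterfly. -/
noncomputable def butterflyPolar (b u : K × K) : K × K →+ ZMod 2 :=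
  AddMonoidHom.mk' (fun x => Algebra.trace (ZMod 2) K
    (butterflyForm (iterateFrobenius K 2 i) α b u x +
      butterflyForm (iterateFrobenius K 2 i) α b x u)) fun x y => by
    rw [butterflyForm_add_left, butterflyForm_add_right, ← map_add]
    congr 1
    ring

theorem butterflyPolar_apply (b u x : K × K) : butterflyPolar i α b u x =
    Algebra.trace (ZMod 2) K (butterflyForm (iterateFrobenius K 2 i) α b u x +
      butterflyForm (iterateFrobenius K 2 i) α b x u) := rfl

end Polarization

/-! ### Walsh spectra of the two butterflies. -/

section Spectrum

variable {K : Type*} [Field K] [Fintype K] [Algebra (ZMod 2) K]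

theorem walsh_eq_sum_sign (F : K × K → K × K) (a b : K × K) :
    walsh F a b = ∑ x : K × K, sign (Algebra.trace (ZMod 2) K
      (b.1 * (F x).1 + b.2 * (F x).2 + a.1 * x.1 + a.2 * x.2)) := rfl

/-- The open and the closed butterfly have affinely equivalent graphs. -/
theorem walsh_openButterfly {e : ℕ} (he : Function.Bijective (fun x : K => x ^ e)) (α : K)
    (a b : K × K) :
    walsh (openButterfly e α) a b = walsh (closedButterfly e α) (b.2, a.2) (b.1, a.1) := by
  -- With x = R_y(u), the open butterfly sends (R_y(u), y) to (R_u(y), u), while the closed one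
  -- sends (u, y) to (R_u(y), R_y(u)).
  have hbij : Function.Bijective (fun p : K × K => (keyedPerm e α p.2 p.1, p.2)) :=
    Finite.injective_iff_bijective.1 fun p q hpq => by
      obtain ⟨h1, h2⟩ := Prod.mk_inj.1 hpq
      rw [h2] at h1
      exact Prod.ext ((keyedPerm_bijective he α q.2).1 h1) h2
  rw [walsh_eq_sum_sign, walsh_eq_sum_sign, ← hbij.sum_comp]
  refine Finset.sum_congr rfl fun p _ => ?_
  congr 2
  simp only [openButterfly, closedButterfly, keyedPermInv_keyedPerm he]
  ring

theorem walsh_closedButterfly_swap (e : ℕ) (α : K) (a b : K × K) :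
    walsh (closedButterfly e α) a.swap b.swap = walsh (closedButterfly e α) a b := by
  rw [walsh_eq_sum_sign, walsh_eq_sum_sign, ← (Equiv.prodComm K K).sum_comp]
  refine Finset.sum_congr rfl fun p _ => ?_
  congr 2
  simp only [closedButterfly, Equiv.prodComm_apply, Prod.fst_swap, Prod.snd_swap]
  ring

theorem walsh_zero_right (F : K × K → K × K) {a : K × K} (ha : a ≠ 0) : walsh F a 0 = 0 := by
  rw [← sum_sign_addMonoidHom_eq_zero (traceFunctional_ne_zero ha), walsh_eq_sum_sign]
  refine Finset.sum_congr rfl fun x _ => ?_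
  rw [traceFunctional_apply]
  congr 2
  simp only [Prod.fst_zero, Prod.snd_zero]
  ring

/-- The exchange of frequencies need not preserve b ≠ 0. A vanishing image yields the Walsh value 0,
whence `h0`; conversely, the symmetry of the closed butterfly makes the first entry of b nonzero. -/
theorem walshSpectrum_openButterfly {e : ℕ} (he : Function.Bijective (fun x : K => x ^ e)) (α : K)
    (h0 : (0 : ℤ) ∈ walshSpectrum (closedButterfly e α)) :
    walshSpectrum (openButterfly e α) = walshSpectrum (closedButterfly e α) := by
  ext w
  constructor
  · rintro ⟨a, b, hb, rfl⟩
    rw [walsh_openButterfly he]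
    by_cases h : ((b.1, a.1) : K × K) = 0
    · have hb2 : b.2 ≠ 0 := fun h2 => hb (Prod.ext (Prod.mk_inj.1 h).1 h2)
      rw [h, walsh_zero_right _ fun h2 => hb2 (congrArg Prod.fst h2)]
      exact h0
    · exact ⟨_, _, h, rfl⟩
  · rintro ⟨a, b, hb, rfl⟩
    have key : ∀ a b : K × K, b.1 ≠ 0 →
        walsh (closedButterfly e α) a b ∈ walshSpectrum (openButterfly e α) := fun a b hb =>
      ⟨(b.2, a.2), (b.1, a.1), fun h => hb (congrArg Prod.fst h), walsh_openButterfly he α _ _⟩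
    by_cases h1 : b.1 = 0
    · rw [← walsh_closedButterfly_swap]
      exact key _ _ fun h2 => hb (Prod.ext h1 h2)
    · exact key _ _ h1

theorem finrank_prod_eq {k : ℕ} (hK : Fintype.card K = 2 ^ k) :
    Module.finrank (ZMod 2) (K × K) = 2 * k := by
  have h := Module.card_eq_pow_finrank (K := ZMod 2) (V := K)
  rw [hK, ZMod.card] at h
  rw [Module.finrank_prod, ← Nat.pow_right_injective le_rfl h, two_mul]

theorem nonlinearity_eq_of_walshSpectrum_eq {k : ℕ} (hK : Fintype.card K = 2 ^ k)
    {F : K × K → K × K}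
    (hF : walshSpectrum F = {0, 2 ^ k, -2 ^ k, 2 ^ (k + 1), -2 ^ (k + 1)}) :
    nonlinearity F = 2 ^ (2 * k - 1) - 2 ^ k := by
  have hsup : ⨆ p : (K × K) × {b : K × K // b ≠ 0}, |(walsh F p.1 p.2.1 : ℝ)| = 2 ^ (k + 1) := by
    obtain ⟨a, b, hb, hw⟩ : (2 ^ (k + 1) : ℤ) ∈ walshSpectrum F := by rw [hF]; simp
    have hle : ∀ p : (K × K) × {b : K × K // b ≠ 0}, |(walsh F p.1 p.2.1 : ℝ)| ≤ 2 ^ (k + 1) := by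
      intro p
      have hmem : walsh F p.1 p.2.1 ∈ walshSpectrum F := ⟨_, _, p.2.2, rfl⟩
      rw [hF] at hmem
      have hk : (2 : ℝ) ^ k ≤ 2 ^ (k + 1) := pow_le_pow_right₀ one_le_two k.le_succ
      rcases hmem with h | h | h | h | h <;> rw [h] <;> push_cast <;>
        simp only [abs_neg, abs_pow, abs_two, abs_zero, le_refl, hk]
      positivity
    refine le_antisymm ?_ ?_
    · have : Nonempty ((K × K) × {b : K × K // b ≠ 0}) := ⟨(a, ⟨b, hb⟩)⟩
      exact ciSup_le hle
    · refine le_trans (le_of_eq ?_) (le_ciSup (Set.finite_range _).bddAbove (a, ⟨b, hb⟩))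
      simp [hw]
  rw [nonlinearity, hsup, finrank_prod_eq hK]
  ring

variable [CharP K 2] {i : ℕ} {α : K}

/-- The factor 2^t acts as an outer Frobenius, which the trace absorbs once b is twisted likewise.
-/
theorem walsh_closedButterfly_eq (t : ℕ) (a b : K × K) :
    walsh (closedButterfly ((2 ^ i + 1) * 2 ^ t) α) a
        (iterateFrobenius K 2 t b.1, iterateFrobenius K 2 t b.2) =
      ∑ x, sign (Algebra.trace (ZMod 2) K (butterflyForm (iterateFrobenius K 2 i) α b x x) +
        traceFunctional a x) := by
  rw [walsh_eq_sum_sign]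
  refine Finset.sum_congr rfl fun x _ => ?_
  congr 1
  rw [traceFunctional_apply, ← trace_iterateFrobenius t (butterflyForm _ _ _ _ _), ← map_add]
  congr 1
  simp only [closedButterfly, keyedPerm_eq_map, butterflyForm, map_add, map_mul]
  ring

theorem mem_butterflyRadical_iff_polar_eq_zero (b u : K × K) :
    u ∈ butterflyRadical (iterateFrobenius K 2 i) α b ↔ butterflyPolar i α b u = 0 := by
  rw [mem_butterflyRadical]
  constructor
  · intro h
    refine DFunLike.ext _ _ fun x => ?_
    rw [butterflyPolar_apply, map_add, h x, trace_iterateFrobenius, CharTwo.add_self_eq_zero]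
    rfl
  · intro h q
    rw [← CharTwo.add_eq_zero]
    refine eq_zero_of_trace_mul_eq_zero fun l => ?_
    -- Replacing q by m q multiplies T(u, q) by σ(m) and T(q, u) by m; trace invariance under σ then
    -- lets σ(m) factor out.
    obtain ⟨m, rfl⟩ := Finite.surjective_of_injective (iterateFrobenius K 2 i).injective l
    have h1 := DFunLike.congr_fun h (m • q)
    rw [butterflyPolar_apply, butterflyForm_smul_left, butterflyForm_smul_right, map_add,
      ← trace_iterateFrobenius i (m * _), ← map_add, map_mul, ← mul_add] at h1
    exact h1

theorem sq_walsh_closedButterfly (t : ℕ) (a b : K × K) :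
    walsh (closedButterfly ((2 ^ i + 1) * 2 ^ t) α) a
        (iterateFrobenius K 2 t b.1, iterateFrobenius K 2 t b.2) ^ 2 = 0 ∨
      walsh (closedButterfly ((2 ^ i + 1) * 2 ^ t) α) a
        (iterateFrobenius K 2 t b.1, iterateFrobenius K 2 t b.2) ^ 2 =
      Fintype.card (K × K) *
        (butterflyRadical (iterateFrobenius K 2 i) α b : Set (K × K)).ncard := by
  rw [walsh_closedButterfly_eq]
  refine sq_sum_sign_eq (B := butterflyPolar i α b) (fun x u => ?_) _
    (mem_butterflyRadical_iff_polar_eq_zero b)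
  rw [butterflyForm_add_left, butterflyForm_add_right, butterflyForm_add_right,
    butterflyPolar_apply]
  simp only [map_add]
  ring

/-- The Walsh spectrum of the closed butterfly. -/
theorem walshSpectrum_closedButterfly {k : ℕ} (hK : Fintype.card K = 2 ^ k) (hk : Odd k)
    (hi : Nat.gcd i k = 1) (hα0 : α ≠ 0) (hα1 : α ≠ 1) (t : ℕ) :
    walshSpectrum (closedButterfly ((2 ^ i + 1) * 2 ^ t) α) =
      {0, 2 ^ k, -2 ^ k, 2 ^ (k + 1), -2 ^ (k + 1)} := by
  have h2 : (2 : K) = 0 := CharTwo.two_eq_zero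
  have hσ := eq_zero_or_one_of_iterateFrobenius_sq hK hk hi
  classical
  -- The three distinct elements 0, 1, α rule out k = 1.
  obtain ⟨n, rfl, hn⟩ : ∃ n, k = n + 2 ∧ Odd n := by
    obtain ⟨m, rfl⟩ := hk
    rcases m with _ | m
    · have hle : ({0, 1, α} : Finset K).card ≤ Fintype.card K := Finset.card_le_univ _
      rw [Finset.card_eq_three.2 ⟨0, 1, α, zero_ne_one, hα0.symm, hα1.symm, rfl⟩, hK] at hle
      norm_num at hle
    · exact ⟨2 * m + 1, by ring, odd_two_mul_add_one m⟩
  set k := n + 2 with hkn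
  set F := closedButterfly ((2 ^ i + 1) * 2 ^ t) α with hF
  set τ := iterateFrobenius K 2 t with hτ
  set σ := iterateFrobenius K 2 i with hσdef
  have hcard : (Fintype.card (K × K) : ℤ) = 2 ^ (2 * k) := by
    rw [Fintype.card_prod, hK]; push_cast; ring
  have hpos : (0 : ℤ) < 2 ^ (2 * k) := by positivity
  have hval : ∀ a b : K × K, b ≠ 0 → _ := fun a b hb => plateaued_values (k := k)
    (by rw [← hcard]; exact sq_walsh_closedButterfly (i := i) (α := α) t a b)
    (butterflyRadical_ncard_le h2 hσ hα0 hα1 hb)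
  have hne : ∀ b : K × K, b ≠ 0 → (τ b.1, τ b.2) ≠ 0 := fun b hb h =>
    hb (Prod.ext ((map_eq_zero τ).1 (congrArg Prod.fst h))
      ((map_eq_zero τ).1 (congrArg Prod.snd h)))
  have hmem : ∀ {w : ℤ} {b : K × K}, b ≠ 0 → (∃ a, walsh F a (τ b.1, τ b.2) = w) →
      w ∈ walshSpectrum F := fun hb ⟨a, h⟩ => ⟨a, _, hne _ hb, h⟩
  have hm1 : ∀ b : K × K, ∑ a, walsh F a (τ b.1, τ b.2) = 2 ^ (2 * k) := fun b => by
    simp only [hF, hτ, walsh_closedButterfly_eq]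
    rw [sum_walsh_eq, hcard]
    simp [butterflyForm, sign_zero]
  have hm2 : ∀ b : K × K, ∑ a, walsh F a (τ b.1, τ b.2) ^ 2 = (2 ^ (2 * k)) ^ 2 := fun b => by
    simp only [hF, hτ, walsh_closedButterfly_eq]
    rw [sum_sq_walsh_eq, hcard]
  have hpow : ∀ {m l : ℕ}, m ≠ l → (2 ^ m : ℤ) ≠ 2 ^ l := fun h h' =>
    h (pow_right_injective₀ two_pos (by norm_num) h')
  obtain ⟨b₀, hb₀, hr₀⟩ := exists_butterflyRadical_ncard_le_two h2 hσ hα0 hα1 hn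
    (iterateFrobenius_pow_eq_one hK) (prod_iterateFrobenius_injective hK hi)
  have hb₁ : ((1, 0) : K × K) ≠ 0 := fun h => one_ne_zero (Prod.mk_inj.1 h).1
  have hr₁ : 2 ≤ (butterflyRadical σ α ((1, 0) : K × K) : Set (K × K)).ncard := by
    refine (Set.one_lt_ncard (Set.toFinite _)).2 ⟨0, zero_mem _, (0, 1), fun q => ?_,
      fun h => one_ne_zero (Prod.mk_inj.1 h).2.symm⟩
    simp [butterflyForm]
  have hW₀ := fun a => (hval a b₀ hb₀).1 hr₀
  have hW₁ := fun a => (hval a (1, 0) hb₁).2 hr₁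
  obtain ⟨h₀, h₀'⟩ := exists_eq_and_exists_eq_neg hpos (by positivity) hW₀ (hm1 b₀) (hm2 b₀)
    (hpow (by omega))
  obtain ⟨h₁, h₁'⟩ := exists_eq_and_exists_eq_neg hpos (by positivity) hW₁ (hm1 _) (hm2 _)
    (hpow (by omega))
  -- The component (1, 0) is needed here: at amplitude 2^k one has R² = N, and the moments do not
  -- force a zero.
  have h₂ := exists_eq_zero_of_plateaued hpos hW₁ hcard (hm2 _)
    (by rw [← pow_mul]; exact hpow (by omega))
  ext w
  constructor
  · rintro ⟨a, b, hb, rfl⟩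
    obtain ⟨c, hc⟩ := Finite.surjective_of_injective τ.injective b.1
    obtain ⟨d, hd⟩ := Finite.surjective_of_injective τ.injective b.2
    have hcd : ((c, d) : K × K) ≠ 0 := fun h => hb (Prod.ext
      (by rw [← hc, (Prod.mk_inj.1 h).1, map_zero]; rfl)
      (by rw [← hd, (Prod.mk_inj.1 h).2, map_zero]; rfl))
    have hb' : b = (τ c, τ d) := Prod.ext hc.symm hd.symm
    rw [hb']
    obtain ⟨hv, hv'⟩ := hval a (c, d) hcd
    simp only [Set.mem_insert_iff, Set.mem_singleton_iff]
    rcases le_total (butterflyRadical σ α (c, d) : Set (K × K)).ncard 2 with h | h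
    · rcases hv h with h | h | h
      exacts [Or.inl h, Or.inr (Or.inl h), Or.inr (Or.inr (Or.inl h))]
    · rcases hv' h with h | h | h
      exacts [Or.inl h, Or.inr (Or.inr (Or.inr (Or.inl h))),
        Or.inr (Or.inr (Or.inr (Or.inr h)))]
  · rintro (rfl | rfl | rfl | rfl | rfl)
    exacts [hmem hb₁ h₂, hmem hb₀ h₀, hmem hb₀ h₀', hmem hb₁ h₁, hmem hb₁ h₁']

end Spectrum

end Butterfly

theorem mainTheorem3 {K : Type*} [Field K] [Fintype K] [Algebra (ZMod 2) K]
    (k i t : ℕ) (hK : Fintype.card K = 2 ^ k) (hk : Odd k) (hi : Nat.gcd i k = 1)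
    (ht : t ≤ k - 1) (α : K) (hα0 : α ≠ 0) (hα1 : α ≠ 1)
    (e : ℕ) (he : e = (2 ^ i + 1) * 2 ^ t) :
    (Butterfly.nonlinearity (Butterfly.openButterfly e α) = 2 ^ (2 * k - 1) - 2 ^ k ∧
      Butterfly.nonlinearity (Butterfly.closedButterfly e α) = 2 ^ (2 * k - 1) - 2 ^ k) ∧
    (Butterfly.IsOptimalNonlinear (Butterfly.openButterfly e α) ∧
      Butterfly.IsOptimalNonlinear (Butterfly.closedButterfly e α)) ∧
    (Butterfly.walshSpectrum (Butterfly.openButterfly e α) =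
        {0, 2 ^ k, -2 ^ k, 2 ^ (k + 1), -2 ^ (k + 1)} ∧
      Butterfly.walshSpectrum (Butterfly.closedButterfly e α) =
        {0, 2 ^ k, -2 ^ k, 2 ^ (k + 1), -2 ^ (k + 1)}) := by
  subst he
  have : CharP K 2 := charP_of_injective_algebraMap (algebraMap (ZMod 2) K).injective 2
  have hV := Butterfly.walshSpectrum_closedButterfly hK hk hi hα0 hα1 t
  have hH := Butterfly.walshSpectrum_openButterfly (Butterfly.exponent_bijective hK hk hi t) α
    (by rw [hV]; simp)
  rw [hV] at hH
  have nV := Butterfly.nonlinearity_eq_of_walshSpectrum_eq hK hV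
  have nH := Butterfly.nonlinearity_eq_of_walshSpectrum_eq hK hH
  refine ⟨⟨nH, nV⟩, ⟨?_, ?_⟩, hH, hV⟩
  · rw [Butterfly.IsOptimalNonlinear, nH, Butterfly.finrank_prod_eq hK,
      Nat.mul_div_cancel_left _ two_pos]
  · rw [Butterfly.IsOptimalNonlinear, nV, Butterfly.finrank_prod_eq hK,
      Nat.mul_div_cancel_left _ two_pos]
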